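/- For $r\in(1,\infty)$ let $r':=r/(r-1)$ denote the Hölder conjugate. Let $(\Omega,\mathcal A,\mathbb P)$ be a probability space and $(S,\mathcal S,\mu)$ a $\sigma$-finite measure space with the *approximation-by-averaging property*: for every $n\in\mathbb N$ there is a finite or countable family $\{B^n_k\}_{k\in K_n}$ of pairwise disjoint measurable sets with $\mu(B_k^n)\in(0,\infty)$, such that for every Banach space $E$, every $p\in[1,\infty)$ and every $f\in L^p(S;E)$ the functions $f_n:=\sum_{k\in K_n}\mathbf 1_{B_k^n}\,\mu(B_k^n)^{-1}\int_{B_k^n}f\,\mathrm d\mu$ converge to $f$ in $L^p(S;E)$. Let $q\in(1,2)$, $p\in[1,q]$, $\widetilde q\in[q,\infty)$, $\widehat q:=\min\{\widetilde q,2\}$, and $X\in L^1(\Omega;L^p(S))$. For $\ell\in\mathbb N=\{1,2,\dots\}$ let $X_\ell\in L^{\widetilde q}(\Omega;L^p(S))\cap L^p(S;L^{\widetilde q}(\Omega))$, where membership of an $L^p(S)$-valued random variable in $L^p(S;L^{r}(\Omega))$, and its norm there, are understood through a jointly measurable version on $S\times\Omega$. Set $X_0:=0$, $\xi_\ell:=X_\ell-X_{\ell-1}$,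 and for each $\ell\in\mathbb N$ let $(\xi_{\ell,j})_{j\in\mathbb N}\subset L^{\widetilde q}(\Omega;L^p(S))\cap L^p(S;L^{\widetilde q}(\Omega))$ be a sequence of independent copies of $\xi_\ell$. Let $\mathcal C_\ell$ be the cost of generating one sample of $\xi_\ell$. Suppose that there are constants $\alpha,\gamma,C_\alpha,C_\beta,C_\gamma,b_1,c_1,c_2\in(0,\infty)$, $b_0\in\mathbb R$, $A\in(1,\infty)$, and numbers $N_\ell$ with $c_1A^\ell\le N_\ell\le c_2A^\ell$, such that $\beta(r):=b_0+\frac{b_1}{r}>0$ for all $r\in[q,\widehat q]$ and, for all $\ell\in\mathbb N$ and all $r\in[q,\widehat q]$, \[ \|\mathbb E[X]-\mathbb E[X_\ell]\|_{L^p(S)}\le C_\alpha N_\ell^{-\alpha},\qquad \|X_\ell-\mathbb E[X_\ell]-(X_{\ell-1}-\mathbb E[X_{\ell-1}])\|_{L^p(S;L^r(\Omega))}\le C_\beta N_\ell^{-\beta(r)},\qquad \mathcal C_\ell\le C_\gamma N_\ell^{\gamma}. \] Put $t:=\frac{\gamma+b_1}{b_0+b_1}$ and, for $\epsilon\in(0,\frac12]$,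 \[ \Phi(\epsilon):=\epsilon^{-\frac{\gamma}{\alpha}}+ \begin{cases} \epsilon^{-\widehat q'} & \text{if } t<\widehat q',\\ \epsilon^{-\widehat q'}|\log_A\epsilon|^{\widehat q'+1} & \text{if } t=\widehat q',\\ \epsilon^{-\widehat q'-\frac{\gamma+b_1-(b_0+b_1)\widehat q'}{\alpha}} & \text{if } t\in(\widehat q',q'] \text{ and } \alpha\ge b_0+b_1,\\ \epsilon^{-t}|\log_A\epsilon|^{t+1} & \text{if } t\in(\widehat q',q'] \text{ and } \alpha<b_0+b_1,\\ \epsilon^{-\widehat q'-\frac{\gamma+b_1-(b_0+b_1)\widehat q'}{\alpha}} & \text{if } t>q' \text{ and } \alpha\ge b_0+b_1,\\ \epsilon^{-q'-\frac{\gamma+b_1-(b_0+b_1)q'}{\alpha}} & \text{if } t>q' \text{ and } \alpha<b_0+b_1. \end{cases} \] Then there is a constant $C\in(0,\infty)$, depending only on $q,\widetilde q,\alpha,\gamma,b_0,b_1,A,C_\alpha,C_\beta,C_\gamma,c_1,c_2$, such that for every $\epsilon\in(0,\frac12]$ there exist integers $L\in\mathbb N$ and $M_1,\dots,M_L\in\mathbb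 N$ for which the multilevel Monte Carlo estimator for $\mathbb E[X]$ satisfies \[ \biggl\|\mathbb E[X]-\sum_{\ell=1}^L\frac1{M_\ell}\sum_{j=1}^{M_\ell}\xi_{\ell,j}\biggr\|_{L^q(\Omega;L^p(S))}<\epsilon \qquad\text{at a cost}\qquad \sum_{\ell=1}^L M_\ell\,\mathcal C_\ell\le C\,\Phi(\epsilon). \] Moreover, this cost bound is optimal among the bounds obtained from a fixed exponent $r\in[q,\widehat q]$: with \[ \Phi_r(\epsilon):=\epsilon^{-\frac{\gamma}{\alpha}}+ \begin{cases} \epsilon^{-r'} & \text{if } \beta(r)>\frac{\gamma}{r'},\\ \epsilon^{-r'}|\log_A\epsilon|^{r'+1} & \text{if } \beta(r)=\frac{\gamma}{r'},\\ \epsilon^{-r'-\frac{\gamma-\beta(r)r'}{\alpha}} & \text{if } \beta(r)<\frac{\gamma}{r'}, \end{cases} \] there is $r\in[q,\widehat q]$ with $\Phi=\Phi_r$ on $(0,\frac12]$, and for every $r\in[q,\widehat q]$ there is $C_r\in(0,\infty)$ with $\Phi\le C_r\Phi_r$ on $(0,\frac12]$. -/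

import Mathlib

open MeasureTheory ProbabilityTheory Filter Topology
open scoped ENNReal

universe u v w

noncomputable section

namespace MLMC

/-- The function `f_n = ∑_{k ∈ K} 1_{B_k} (1/μ(B_k)) ∫_{B_k} f dμ` obtained by averaging `f` over the
sets `B k`, `k ∈ K`. For pairwise disjoint sets at most one term is nonzero at every point. -/
def blockAverage {S : Type u} [MeasurableSpace S] (μ : Measure S) {E : Type w}
    [NormedAddCommGroup E] [NormedSpace ℝ E] (K : Set ℕ) (B : ℕ → Set S) (f : S → E) : S → E :=
  fun s => ∑' k : K, (B k).indicator (fun _ => ⨍ x in B k, f x ∂μ) s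

/-- The approximation-by-averaging property of a measure space. The countable families of sets
(indexed by subsets `K n` of `ℕ`) do not depend on the Banach space, on the exponent or on the
function. -/
def ApproximationByAveraging {S : Type u} [MeasurableSpace S] (μ : Measure S) : Prop :=
  ∃ (K : ℕ → Set ℕ) (B : ℕ → ℕ → Set S),
    (∀ n, ∀ k ∈ K n, MeasurableSet (B n k) ∧ 0 < μ (B n k) ∧ μ (B n k) < ∞) ∧
    (∀ n, (K n).PairwiseDisjoint (B n)) ∧
    ∀ (E : Type w) [NormedAddCommGroup E] [NormedSpace ℝ E] [CompleteSpace E]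
      (p : ℝ≥0∞), 1 ≤ p → p ≠ ∞ → ∀ f : S → E, MemLp f p μ →
        Tendsto (fun n => eLpNorm (f - blockAverage μ (K n) (B n) f) p μ) atTop (𝓝 0)

section Mixed

variable {S : Type u} [MeasurableSpace S] {Ω : Type v} [MeasurableSpace Ω]
  {μ : Measure S} {p : ℝ≥0∞}

/-- `L^p(S)` carries its Borel σ-algebra. -/
instance lpMeasurableSpace [Fact (1 ≤ p)] : MeasurableSpace (Lp ℝ p μ) := borel _

instance lpBorelSpace [Fact (1 ≤ p)] : BorelSpace (Lp ℝ p μ) := ⟨rfl⟩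

/-- `f` is a jointly measurable version of the `L^p(S)`-valued random variable `η`. -/
def IsVersion (P : Measure Ω) (η : Ω → Lp ℝ p μ) (f : S × Ω → ℝ) : Prop :=
  Measurable f ∧ ∀ᵐ ω ∂P, (η ω : S → ℝ) =ᵐ[μ] fun s => f (s, ω)

/-- `η ∈ L^p(S; L^q(Ω))`: for a jointly measurable version `f` of `η`, the map `s ↦ f(s, ·)` is
an element of the Bochner space `L^p(S; L^q(Ω))`. -/
def MemLpLq (P : Measure Ω) (q : ℝ≥0∞) [Fact (1 ≤ q)] (η : Ω → Lp ℝ p μ) : Prop :=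
  ∃ (f : S × Ω → ℝ) (g : S → Lp ℝ q P), IsVersion P η f ∧
    (∀ᵐ s ∂μ, (g s : Ω → ℝ) =ᵐ[P] fun ω => f (s, ω)) ∧ MemLp g p μ

/-- The norm of `η` in `L^p(S; L^r(Ω))`, computed from a jointly measurable version of `η`.
Versions agree almost everywhere on the product, so for σ-finite `μ` all of them give the
same value, and the infimum only selects it (it is `∞` if there is no version). -/
def mixedNorm (P : Measure Ω) (r : ℝ≥0∞) (η : Ω → Lp ℝ p μ) : ℝ≥0∞ :=
  ⨅ (f : S × Ω → ℝ) (_ : IsVersion P η f),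
    eLpNorm (fun s => eLpNorm (fun ω => f (s, ω)) r P) p μ

variable [Fact (1 ≤ p)]

/-- The level increment `ξ_ℓ = X_ℓ - X_{ℓ-1}`, used for `ℓ ≥ 1`. -/
def increment (X : ℕ → Ω → Lp ℝ p μ) (ℓ : ℕ) (ω : Ω) : Lp ℝ p μ :=
  X ℓ ω - X (ℓ - 1) ω

/-- The multilevel Monte Carlo estimator `∑_{ℓ=1}^L (1/M_ℓ) ∑_j ξ_{ℓ,j}`, with `M_ℓ` samples on
level `ℓ` (numbered from `0`). -/
def estimator (ξ : ℕ → ℕ → Ω → Lp ℝ p μ) (L : ℕ) (M : ℕ → ℕ) (ω : Ω) : Lp ℝ p μ :=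
  ∑ ℓ ∈ Finset.Icc 1 L, (M ℓ : ℝ)⁻¹ • ∑ j ∈ Finset.range (M ℓ), ξ ℓ j ω

/-- The `L^q`-accuracy of the estimator for `E[X]`, in the norm of `L^q(Ω; L^p(S))`. -/
def mlmcError (P : Measure Ω) (q : ℝ) (X : Ω → Lp ℝ p μ) (ξ : ℕ → ℕ → Ω → Lp ℝ p μ)
    (L : ℕ) (M : ℕ → ℕ) : ℝ≥0∞ :=
  eLpNorm (fun ω => (∫ ω', X ω' ∂P) - estimator ξ L M ω) (ENNReal.ofReal q) P

/-- The assumptions on the random variables, their samples and the cost per sample.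
`Xlim` is the random variable whose mean is estimated, `X ℓ` its approximation on level `ℓ ≥ 1`
(with `X 0 = 0`), `ξ ℓ j` are the samples of the increment on level `ℓ`, and `cost ℓ` is the cost
of one such sample. -/
structure Setting (μ : Measure S) (P : Measure Ω) (q qt α γ : ℝ) [Fact (1 ≤ ENNReal.ofReal qt)]
    (β : ℝ → ℝ) (A Cα Cβ Cγ c₁ c₂ : ℝ)
    (Xlim : Ω → Lp ℝ p μ) (X : ℕ → Ω → Lp ℝ p μ) (ξ : ℕ → ℕ → Ω → Lp ℝ p μ)
    (N cost : ℕ → ℝ) : Prop where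
  integrable_lim : MemLp Xlim 1 P
  zero_level : ∀ ω, X 0 ω = 0
  memLp_level : ∀ ℓ, 1 ≤ ℓ → MemLp (X ℓ) (ENNReal.ofReal qt) P
  memLpLq_level : ∀ ℓ, 1 ≤ ℓ → MemLpLq P (ENNReal.ofReal qt) (X ℓ)
  N_equiv : ∀ ℓ, 1 ≤ ℓ → c₁ * A ^ ℓ ≤ N ℓ ∧ N ℓ ≤ c₂ * A ^ ℓ
  bias : ∀ ℓ, 1 ≤ ℓ → ‖(∫ ω, Xlim ω ∂P) - ∫ ω, X ℓ ω ∂P‖ ≤ Cα * N ℓ ^ (-α)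
  strong : ∀ r ∈ Set.Icc q (min qt 2), ∀ ℓ, 1 ≤ ℓ →
    mixedNorm P (ENNReal.ofReal r)
      (fun ω => X ℓ ω - (∫ ω', X ℓ ω' ∂P) - (X (ℓ - 1) ω - ∫ ω', X (ℓ - 1) ω' ∂P))
      ≤ ENNReal.ofReal (Cβ * N ℓ ^ (-β r))
  cost_le : ∀ ℓ, 1 ≤ ℓ → cost ℓ ≤ Cγ * N ℓ ^ γ
  memLp_sample : ∀ ℓ, 1 ≤ ℓ → ∀ j, MemLp (ξ ℓ j) (ENNReal.ofReal qt) P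
  memLpLq_sample : ∀ ℓ, 1 ≤ ℓ → ∀ j, MemLpLq P (ENNReal.ofReal qt) (ξ ℓ j)
  indep : ∀ ℓ, 1 ≤ ℓ → iIndepFun (ξ ℓ) P
  copy : ∀ ℓ, 1 ≤ ℓ → ∀ j, IdentDistrib (ξ ℓ j) (increment X ℓ) P P

end Mixed

/-- The cost of the estimator: `M_ℓ` samples of cost `cost ℓ` on each level `ℓ = 1, …, L`. -/
def mlmcCost (cost : ℕ → ℝ) (L : ℕ) (M : ℕ → ℕ) : ℝ :=
  ∑ ℓ ∈ Finset.Icc 1 L, (M ℓ : ℝ) * cost ℓ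

/-- The cost bound belonging to a fixed exponent `r`, with `r' = r / (r - 1)`. -/
def costBound (α γ : ℝ) (β : ℝ → ℝ) (A r ε : ℝ) : ℝ :=
  let r' := Real.conjExponent r
  if γ / r' < β r then ε ^ (-(γ / α)) + ε ^ (-r')
  else if β r = γ / r' then ε ^ (-(γ / α)) + ε ^ (-r') * |Real.logb A ε| ^ (r' + 1)
  else ε ^ (-(γ / α)) + ε ^ (-r' - (γ - β r * r') / α)

/-- The optimized cost bound for `β(r) = b₀ + b₁ / r`; `qh` stands for `min q̃ 2`. -/
def optimalCostBound (q qh α γ b₀ b₁ A ε : ℝ) : ℝ :=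
  let q' := Real.conjExponent q
  let qh' := Real.conjExponent qh
  let t := (γ + b₁) / (b₀ + b₁)
  if t < qh' then ε ^ (-(γ / α)) + ε ^ (-qh')
  else if t = qh' then ε ^ (-(γ / α)) + ε ^ (-qh') * |Real.logb A ε| ^ (qh' + 1)
  else if t ≤ q' then
    if b₀ + b₁ ≤ α then
      ε ^ (-(γ / α)) + ε ^ (-qh' - (γ + b₁ - (b₀ + b₁) * qh') / α)
    else ε ^ (-(γ / α)) + ε ^ (-t) * |Real.logb A ε| ^ (t + 1)
  else
    if b₀ + b₁ ≤ α then
      ε ^ (-(γ / α)) + ε ^ (-qh' - (γ + b₁ - (b₀ + b₁) * qh') / α)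
    else ε ^ (-(γ / α)) + ε ^ (-q' - (γ + b₁ - (b₀ + b₁) * q') / α)

end MLMC

end

namespace MLMC

/-! The triangle inequality splits the error into the bias at level `L` and the sampling errors of
the levels. For the sampling errors, `p ≤ q` allows Minkowski's inequality to pass from `L^q(Ω;
L^p(S))` to `L^p(S; L^q(Ω))`. At almost every point `s` there remains a sum of independent centered
real variables, to which the von Bahr–Esseen inequality applies with any exponent `r` between `q`
and `2`. The mean of `M` samples thus gains the factor `M^(1/r - 1) = M^(-1/r')` on the norm in
`L^p(S; L^r(Ω))` (`eLpNorm_sum_le_mixedNorm`). Elements of `L^p(S)` have no values at points, so a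
single jointly measurable evaluation map on a separable set (`exists_measurable_evaluation`) is used
to transfer independence and equality of laws to each `s`.

For fixed `r`, choosing `L` from the bias and sample numbers that decay geometrically in the level
reduces the cost to geometric sums, whose growing, constant or decaying behaviour gives the three
cases of `Φ_r` (`exists_levels_and_samples`).

In the variable `x = r'` the polynomial order of the sampling part of `Φ_r` is the piecewise linear
function `x + max 0 ((γ + b₁ - (b₀ + b₁) x) / α)`, with kink at `t`. Its minimum over the admissible
interval lies at an endpoint or at the kink, which explains the cases of `Φ`
(`samplingOrder_optimalConj_le`). -/

/-! ### Scalar inequalities for powers of the absolute value. -/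

theorem abs_rpow_mul_self_of_nonneg {s x : ℝ} (hs : 0 < s) (hx : 0 ≤ x) :
    |x| ^ (s - 1) * x = x ^ s := by
  rcases hx.eq_or_lt with rfl | hx
  · simp [Real.zero_rpow hs.ne']
  · rw [abs_of_pos hx, Real.rpow_sub_one hx.ne']
    field_simp

theorem rpow_sub_rpow_le_rpow_sub {s x y : ℝ} (hs : 0 < s) (hs1 : s ≤ 1) (hy : 0 ≤ y)
    (hxy : y ≤ x) : x ^ s - y ^ s ≤ (x - y) ^ s := by
  have h := Real.rpow_add_le_add_rpow hy (sub_nonneg.2 hxy) hs.le hs1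
  rw [add_sub_cancel] at h
  linarith

/-- For equal signs this is subadditivity of `t ↦ t ^ s`; for opposite signs each of the two powers
is at most `|x - y| ^ s`, hence the factor 2. With `s = r - 1` it controls the derivative of `|·| ^
r`. -/
theorem abs_signed_rpow_sub_le {s : ℝ} (hs : 0 < s) (hs1 : s ≤ 1) (x y : ℝ) :
    |(|x| ^ (s - 1) * x) - |y| ^ (s - 1) * y| ≤ 2 * |x - y| ^ s := by
  have nonneg : ∀ x y : ℝ, 0 ≤ y → y ≤ x →
      |(|x| ^ (s - 1) * x) - |y| ^ (s - 1) * y| ≤ 2 * |x - y| ^ s := by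
    intro x y hy hxy
    rw [abs_rpow_mul_self_of_nonneg hs hy, abs_rpow_mul_self_of_nonneg hs (hy.trans hxy),
      abs_of_nonneg (sub_nonneg.2 hxy),
      abs_of_nonneg (sub_nonneg.2 (Real.rpow_le_rpow hy hxy hs.le))]
    have := Real.rpow_nonneg (sub_nonneg.2 hxy) s
    linarith [rpow_sub_rpow_le_rpow_sub hs hs1 hy hxy]
  have mixed : ∀ x y : ℝ, y ≤ 0 → 0 ≤ x →
      |(|x| ^ (s - 1) * x) - |y| ^ (s - 1) * y| ≤ 2 * |x - y| ^ s := by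
    intro x y hy hx
    have e : |y| ^ (s - 1) * y = -((-y) ^ s) := by
      rw [← abs_rpow_mul_self_of_nonneg hs (neg_nonneg.2 hy), abs_neg]
      ring
    rw [abs_rpow_mul_self_of_nonneg hs hx, e, abs_of_nonneg (by linarith : 0 ≤ x - y), sub_neg_eq_add,
      abs_of_nonneg (add_nonneg (Real.rpow_nonneg hx _) (Real.rpow_nonneg (by linarith) _))]
    have h1 : x ^ s ≤ (x - y) ^ s := Real.rpow_le_rpow hx (by linarith) hs.le
    have h2 : (-y) ^ s ≤ (x - y) ^ s := Real.rpow_le_rpow (by linarith) (by linarith) hs.le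
    linarith
  have ordered : ∀ x y : ℝ, y ≤ x →
      |(|x| ^ (s - 1) * x) - |y| ^ (s - 1) * y| ≤ 2 * |x - y| ^ s := by
    intro x y hxy
    rcases le_total 0 y with hy | hy
    · exact nonneg x y hy hxy
    · rcases le_total 0 x with hx | hx
      · exact mixed x y hy hx
      · have := nonneg (-y) (-x) (by linarith) (by linarith)
        rw [abs_neg, abs_neg] at this
        convert this using 2
        · ring
        · congr 2; ring
  rcases le_total y x with h | h
  · exact ordered x y h
  · rw [abs_sub_comm, abs_sub_comm x y]
    exact ordered y x h

/-- First-order Taylor bound for `|·| ^ r`, `1 < r ≤ 2`. -/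
theorem abs_add_rpow_le {r : ℝ} (hr : 1 < r) (hr2 : r ≤ 2) (a b : ℝ) :
    |a + b| ^ r ≤ |a| ^ r + r * (|a| ^ (r - 2) * a) * b + 4 * |b| ^ r := by
  have hd : ∀ t : ℝ, HasDerivAt (fun t : ℝ => |a + t * b| ^ r)
      (r * |a + t * b| ^ (r - 2) * (a + t * b) * b) t := by
    intro t
    have h1 : HasDerivAt (fun t : ℝ => a + t * b) b t := by
      simpa using ((hasDerivAt_id t).mul_const b).const_add a
    exact (hasDerivAt_abs_rpow (a + t * b) hr).comp t h1
  -- The mean value theorem on the segment from `a` to `a + b`. Replacing the derivative at `θ` by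
  -- the one at `0` costs at most `2 r |b| ^ r ≤ 4 |b| ^ r`.
  obtain ⟨θ, hθ, h⟩ := exists_hasDerivAt_eq_slope (fun t : ℝ => |a + t * b| ^ r) _ zero_lt_one
    (fun t _ => (hd t).continuousAt.continuousWithinAt) (fun t _ => hd t)
  simp only [one_mul, zero_mul, add_zero, sub_zero, div_one] at h
  have hφ := abs_signed_rpow_sub_le (s := r - 1) (by linarith) (by linarith) (a + θ * b) a
  have e2 : r - 1 - 1 = r - 2 := by ring
  rw [e2] at hφ
  have hθb : |a + θ * b - a| ^ (r - 1) ≤ |b| ^ (r - 1) := by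
    refine Real.rpow_le_rpow (abs_nonneg _) ?_ (by linarith)
    rw [add_sub_cancel_left, abs_mul, abs_of_pos hθ.1]
    nlinarith [abs_nonneg b, hθ.2]
  have hb : |b| ^ (r - 1) * |b| = |b| ^ r := by
    rcases eq_or_ne b 0 with rfl | hb
    · simp [Real.zero_rpow (by linarith : r ≠ 0)]
    · rw [Real.rpow_sub_one (abs_ne_zero.2 hb)]
      field_simp
  have key : (|a + θ * b| ^ (r - 2) * (a + θ * b) - |a| ^ (r - 2) * a) * b ≤ 2 * |b| ^ r := by
    refine (le_abs_self _).trans ?_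
    rw [abs_mul, ← hb, ← mul_assoc]
    exact mul_le_mul_of_nonneg_right (by linarith) (abs_nonneg b)
  have hnn : 0 ≤ |b| ^ r := Real.rpow_nonneg (abs_nonneg b) r
  nlinarith

/-! ### Moments of sums of independent real random variables. -/

section Probability

variable {Ω : Type*} [MeasurableSpace Ω] {P : Measure Ω}

/-- Integrability of the cross term in the Taylor bound: `|u| ^ (r - 1) * |v| ≤ |u| ^ r + |v| ^ r`,
by comparing `|u|` with `|v|`. -/
theorem integrable_signed_rpow_mul {r : ℝ} (hr : 1 < r) {U V : Ω → ℝ}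
    (hU : MemLp U (ENNReal.ofReal r) P) (hV : MemLp V (ENNReal.ofReal r) P) :
    Integrable (fun ω => |U ω| ^ (r - 2) * U ω * V ω) P := by
  have hr0 : 0 < r := by linarith
  have h0 : ENNReal.ofReal r ≠ 0 := by simpa using hr0
  have hU' := hU.integrable_norm_rpow h0 ENNReal.ofReal_ne_top
  have hV' := hV.integrable_norm_rpow h0 ENNReal.ofReal_ne_top
  rw [ENNReal.toReal_ofReal hr0.le] at hU' hV'
  have hm : AEStronglyMeasurable (fun ω => |U ω| ^ (r - 2) * U ω * V ω) P := by
    have hUm := hU.aestronglyMeasurable.aemeasurable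
    have hVm := hV.aestronglyMeasurable.aemeasurable
    refine AEMeasurable.aestronglyMeasurable ?_
    have : AEMeasurable (fun ω => |U ω|) P := by simpa using hUm.norm
    exact ((this.pow_const _).mul hUm).mul hVm
  refine (hU'.add hV').mono' hm (ae_of_all _ fun ω => ?_)
  have e : ‖|U ω| ^ (r - 2) * U ω * V ω‖ = |U ω| ^ (r - 1) * |V ω| := by
    rw [norm_mul, norm_mul, Real.norm_eq_abs, Real.norm_eq_abs, Real.norm_eq_abs,
      abs_of_nonneg (Real.rpow_nonneg (abs_nonneg _) _)]
    have := abs_rpow_mul_self_of_nonneg (s := r - 1) (by linarith) (abs_nonneg (U ω))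
    rw [abs_abs, show r - 1 - 1 = r - 2 by ring] at this
    rw [this]
  rw [e]
  have pow : ∀ x : ℝ, 0 ≤ x → x ^ (r - 1) * x = x ^ r := by
    intro x hx
    rcases hx.eq_or_lt with rfl | hx
    · simp [Real.zero_rpow hr0.ne']
    · rw [Real.rpow_sub_one hx.ne']; field_simp
  have nU := Real.rpow_nonneg (abs_nonneg (U ω)) r
  have nV := Real.rpow_nonneg (abs_nonneg (V ω)) r
  simp only [Pi.add_apply, Real.norm_eq_abs]
  rcases le_total |U ω| |V ω| with h | h
  · have := mul_le_mul_of_nonneg_right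
      (Real.rpow_le_rpow (abs_nonneg _) h (by linarith : 0 ≤ r - 1)) (abs_nonneg (V ω))
    rw [pow _ (abs_nonneg _)] at this
    linarith
  · have := mul_le_mul_of_nonneg_left h (Real.rpow_nonneg (abs_nonneg (U ω)) (r - 1))
    rw [pow _ (abs_nonneg _)] at this
    linarith

/-- The von Bahr–Esseen inequality for independent centered real random variables. -/
theorem integral_abs_sum_rpow_le [IsProbabilityMeasure P] {r : ℝ} (hr : 1 < r) (hr2 : r ≤ 2)
    {Z : ℕ → Ω → ℝ} (hind : iIndepFun Z P) (hZ : ∀ j, MemLp (Z j) (ENNReal.ofReal r) P)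
    (h0 : ∀ j, ∫ ω, Z j ω ∂P = 0) (n : ℕ) :
    ∫ ω, |∑ j ∈ Finset.range n, Z j ω| ^ r ∂P
      ≤ 4 * ∑ j ∈ Finset.range n, ∫ ω, |Z j ω| ^ r ∂P := by
  have hr0 : 0 < r := by linarith
  have hne : ENNReal.ofReal r ≠ 0 := by simpa using hr0
  have int : ∀ {U : Ω → ℝ}, MemLp U (ENNReal.ofReal r) P → Integrable (fun ω => |U ω| ^ r) P := by
    intro U hU
    have := hU.integrable_norm_rpow hne ENNReal.ofReal_ne_top
    rwa [ENNReal.toReal_ofReal hr0.le] at this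
  induction n with
  | zero => simp [Real.zero_rpow hr0.ne']
  | succ n ih =>
    set U : Ω → ℝ := fun ω => ∑ j ∈ Finset.range n, Z j ω with hUdef
    have hU : MemLp U (ENNReal.ofReal r) P := memLp_finsetSum _ fun j _ => hZ j
    have hUZ : IndepFun U (Z n) P := by
      have := hind.indepFun_finsetSum_of_notMem₀
        (fun j => (hZ j).aestronglyMeasurable.aemeasurable) (s := Finset.range n) (i := n) (by simp)
      convert this using 1
      ext ω; simp [hUdef]
    have hmeas : Measurable fun x : ℝ => |x| ^ (r - 2) * x := by fun_prop
    -- The linear term of the Taylor bound has mean zero, because `Z n` is centered and independent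
    -- of the partial sum `U`.
    have hcross : ∫ ω, |U ω| ^ (r - 2) * U ω * Z n ω ∂P = 0 := by
      have h := (hUZ.comp hmeas measurable_id).integral_fun_mul_eq_mul_integral
        (hmeas.comp_aemeasurable hU.aestronglyMeasurable.aemeasurable).aestronglyMeasurable
        (hZ n).aestronglyMeasurable
      simp only [Function.comp_apply, id_eq, h0 n, mul_zero] at h
      exact h
    have hcint := integrable_signed_rpow_mul hr hU (hZ n)
    have hsum : Integrable (fun ω => |U ω| ^ r + r * (|U ω| ^ (r - 2) * U ω * Z n ω)) P :=
      (int hU).add (hcint.const_mul r)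
    calc ∫ ω, |∑ j ∈ Finset.range (n + 1), Z j ω| ^ r ∂P
        ≤ ∫ ω, (|U ω| ^ r + r * (|U ω| ^ (r - 2) * U ω * Z n ω) + 4 * |Z n ω| ^ r) ∂P := by
          refine integral_mono_of_nonneg
            (ae_of_all _ fun ω => Real.rpow_nonneg (abs_nonneg _) _)
            (hsum.add ((int (hZ n)).const_mul 4))
            (ae_of_all _ fun ω => ?_)
          simp only [Finset.sum_range_succ]
          have := abs_add_rpow_le hr hr2 (U ω) (Z n ω)
          rw [mul_assoc r] at this
          exact this
      _ = (∫ ω, |U ω| ^ r ∂P) + 4 * ∫ ω, |Z n ω| ^ r ∂P := by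
          rw [integral_add hsum ((int (hZ n)).const_mul 4),
            integral_add (int hU) (hcint.const_mul r), integral_const_mul, integral_const_mul,
            hcross, mul_zero, add_zero]
      _ ≤ _ := by
          rw [Finset.sum_range_succ, mul_add]
          exact add_le_add_left ih _

/-- The value `c = ∞` is admitted so that the bound can be used at points `s` where finiteness of
the moment is not known. -/
theorem eLpNorm_sum_le_of_iIndepFun [IsProbabilityMeasure P] {r : ℝ} (hr : 1 < r) (hr2 : r ≤ 2)
    {Z : ℕ → Ω → ℝ} (hind : iIndepFun Z P) (hZ : ∀ j, AEStronglyMeasurable (Z j) P)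
    (h0 : ∀ j, ∫ ω, Z j ω ∂P = 0) {c : ℝ≥0∞} (hc : ∀ j, eLpNorm (Z j) (ENNReal.ofReal r) P = c)
    {n : ℕ} (hn : 1 ≤ n) :
    eLpNorm (fun ω => ∑ j ∈ Finset.range n, Z j ω) (ENNReal.ofReal r) P
      ≤ ENNReal.ofReal ((4 * n) ^ r⁻¹) * c := by
  have hr0 : 0 < r := by linarith
  have hn0 : (0 : ℝ) < n := by exact_mod_cast hn
  have hne : ENNReal.ofReal r ≠ 0 := by simpa using hr0
  by_cases hct : c = ∞
  · rw [hct, ENNReal.mul_top]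
    · exact le_top
    · simpa using Real.rpow_pos_of_pos (by positivity : (0 : ℝ) < 4 * n) _
  have hmem : ∀ j, MemLp (Z j) (ENNReal.ofReal r) P :=
    fun j => ⟨hZ j, by rw [hc j]; exact lt_top_iff_ne_top.2 hct⟩
  have hval : ∀ {U : Ω → ℝ}, MemLp U (ENNReal.ofReal r) P →
      eLpNorm U (ENNReal.ofReal r) P = ENNReal.ofReal ((∫ ω, |U ω| ^ r ∂P) ^ r⁻¹) := by
    intro U hU
    rw [hU.eLpNorm_eq_integral_rpow_norm hne ENNReal.ofReal_ne_top, ENNReal.toReal_ofReal hr0.le]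
    rfl
  have nonneg : ∀ U : Ω → ℝ, 0 ≤ ∫ ω, |U ω| ^ r ∂P :=
    fun U => integral_nonneg fun ω => Real.rpow_nonneg (abs_nonneg _) _
  have hcomm : ∀ j, ∫ ω, |Z j ω| ^ r ∂P = ∫ ω, |Z 0 ω| ^ r ∂P := by
    intro j
    have h := (hc j).trans (hc 0).symm
    rw [hval (hmem j), hval (hmem 0), ENNReal.ofReal_eq_ofReal_iff
      (Real.rpow_nonneg (nonneg _) _) (Real.rpow_nonneg (nonneg _) _)] at h
    exact (Real.rpow_left_inj (nonneg _) (nonneg _) (inv_ne_zero hr0.ne')).1 h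
  have hB := integral_abs_sum_rpow_le hr hr2 hind hmem h0 n
  simp only [hcomm, Finset.sum_const, Finset.card_range, nsmul_eq_mul] at hB
  rw [hval (memLp_finsetSum _ fun j _ => hmem j), ← hc 0, hval (hmem 0),
    ← ENNReal.ofReal_mul (by positivity), ← Real.mul_rpow (by positivity) (nonneg _)]
  refine ENNReal.ofReal_le_ofReal (Real.rpow_le_rpow (nonneg _) ?_ (by positivity))
  linarith

end Probability

/-! ### Exchange of the order of mixed norms. -/

section Minkowski

variable {S Ω : Type*} [MeasurableSpace S] [MeasurableSpace Ω] {μ : Measure S} {P : Measure Ω}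

/-- Minkowski's integral inequality. -/
theorem lintegral_rpow_lintegral_le [SFinite μ] [SFinite P] {k : ℝ} (hk : 1 ≤ k)
    {G : S → Ω → ℝ≥0∞} (hG : Measurable (Function.uncurry G))
    (hfin : ∫⁻ ω, (∫⁻ s, G s ω ∂μ) ^ k ∂P ≠ ∞) :
    (∫⁻ ω, (∫⁻ s, G s ω ∂μ) ^ k ∂P) ^ (1 / k) ≤ ∫⁻ s, (∫⁻ ω, G s ω ^ k ∂P) ^ (1 / k) ∂μ := by
  rcases hk.eq_or_lt with rfl | hk
  · simp only [ENNReal.rpow_one, div_one]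
    exact (lintegral_lintegral_swap hG.aemeasurable).symm.le
  set k' := Real.conjExponent k with hk'
  have hc : k.HolderConjugate k' := .conjExponent hk
  set H : Ω → ℝ≥0∞ := fun ω => ∫⁻ s, G s ω ∂μ with hH
  have hHm : Measurable H := hG.lintegral_prod_left'
  set I := ∫⁻ ω, H ω ^ k ∂P with hI
  rcases eq_or_ne I 0 with h0 | h0
  · rw [h0, ENNReal.zero_rpow_of_pos (by positivity)]
    exact zero_le
  -- One factor of `H ^ k = H * H ^ (k - 1)` is expanded, the integrals are swapped, and Hölder's
  -- inequality is applied in `ω`. Dividing by `I ^ (1 / k')` then needs `I` to be nonzero and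
  -- finite.
  have hle : I ≤ (∫⁻ s, (∫⁻ ω, G s ω ^ k ∂P) ^ (1 / k) ∂μ) * I ^ (1 / k') := by
    calc I = ∫⁻ ω, ∫⁻ s, G s ω * H ω ^ (k - 1) ∂μ ∂P := by
          refine lintegral_congr fun ω => ?_
          rw [lintegral_mul_const (f := fun s => G s ω) _ (hG.comp measurable_prodMk_right)]
          calc H ω ^ k = H ω ^ (1 + (k - 1)) := by ring_nf
            _ = H ω * H ω ^ (k - 1) := by
              rw [ENNReal.rpow_add_of_nonneg _ _ zero_le_one (by linarith), ENNReal.rpow_one]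
      _ = ∫⁻ s, ∫⁻ ω, G s ω * H ω ^ (k - 1) ∂P ∂μ := by
          rw [lintegral_lintegral_swap]
          exact ((hG.comp measurable_swap).mul
            ((hHm.comp measurable_fst).pow_const _)).aemeasurable
      _ ≤ ∫⁻ s, (∫⁻ ω, G s ω ^ k ∂P) ^ (1 / k) * I ^ (1 / k') ∂μ := by
          refine lintegral_mono fun s => ?_
          have h := ENNReal.lintegral_mul_le_Lp_mul_Lq P hc
            (hG.comp measurable_prodMk_left).aemeasurable (f := G s)
            (hHm.pow_const (k - 1)).aemeasurable
          refine h.trans_eq ?_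
          congr 2
          refine lintegral_congr fun ω => ?_
          rw [← ENNReal.rpow_mul, hc.sub_one_mul_conj]
      _ = _ := by
          rw [lintegral_mul_const']
          exact ENNReal.rpow_ne_top_of_nonneg (by have := hc.symm.pos; positivity) hfin
  have hI' : I ^ (1 / k') ≠ 0 := by
    rw [Ne, ENNReal.rpow_eq_zero_iff]
    push Not
    exact ⟨fun h => absurd h h0, fun h => absurd h hfin⟩
  have hI'' : I ^ (1 / k') ≠ ∞ :=
    ENNReal.rpow_ne_top_of_nonneg (by have := hc.symm.pos; positivity) hfin
  have hsplit : I = I ^ (1 / k) * I ^ (1 / k') := by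
    rw [← ENNReal.rpow_add _ _ h0 hfin, one_div, one_div, hc.inv_add_inv_eq_one, ENNReal.rpow_one]
  exact (ENNReal.mul_le_mul_iff_left hI' hI'').1 (hsplit.symm.le.trans hle)

/-- Minkowski's integral inequality for `|f| ^ p` with exponent `q / p ≥ 1`. -/
theorem eLpNorm_eLpNorm_swap_le [SFinite μ] [SFinite P] {p q : ℝ≥0∞} (hp0 : p ≠ 0) (hpq : p ≤ q)
    (hq : q ≠ ∞) {f : S × Ω → ℝ} (hf : Measurable f)
    (hfin : eLpNorm (fun ω => eLpNorm (fun s => f (s, ω)) p μ) q P ≠ ∞) :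
    eLpNorm (fun ω => eLpNorm (fun s => f (s, ω)) p μ) q P
      ≤ eLpNorm (fun s => eLpNorm (fun ω => f (s, ω)) q P) p μ := by
  have hp : p ≠ ∞ := ne_top_of_le_ne_top hq hpq
  have hq0 : q ≠ 0 := fun h => hp0 (le_antisymm (h ▸ hpq) zero_le)
  have ha : 0 < p.toReal := ENNReal.toReal_pos hp0 hp
  have hb : 0 < q.toReal := ENNReal.toReal_pos hq0 hq
  have hab : p.toReal ≤ q.toReal := ENNReal.toReal_mono hq hpq
  simp only [eLpNorm_eq_lintegral_rpow_enorm_toReal hp0 hp,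
    eLpNorm_eq_lintegral_rpow_enorm_toReal hq0 hq, enorm_eq_self] at hfin ⊢
  set a := p.toReal
  set b := q.toReal
  have h1 : ∀ x : ℝ≥0∞, (x ^ (1 / a)) ^ b = x ^ (b / a) := fun x => by
    rw [← ENNReal.rpow_mul]; congr 1; ring
  have h2 : ∀ x : ℝ≥0∞, (x ^ (1 / b)) ^ a = x ^ (1 / (b / a)) := fun x => by
    rw [← ENNReal.rpow_mul]; congr 1; field_simp
  have h3 : ∀ x : ℝ≥0∞, (x ^ a) ^ (b / a) = x ^ b := fun x => by
    rw [← ENNReal.rpow_mul]; congr 1; field_simp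
  simp only [h1, h2] at hfin ⊢
  have hG : Measurable (Function.uncurry fun s ω => ‖f (s, ω)‖ₑ ^ a) := by
    exact hf.enorm.pow_const a
  have hfin' : ∫⁻ ω, (∫⁻ s, ‖f (s, ω)‖ₑ ^ a ∂μ) ^ (b / a) ∂P ≠ ∞ := by
    intro h
    rw [h, ENNReal.top_rpow_of_pos (by positivity)] at hfin
    exact hfin rfl
  have key := lintegral_rpow_lintegral_le ((one_le_div ha).2 hab) hG hfin'
  simp only [h3] at key
  have := ENNReal.rpow_le_rpow key (by positivity : 0 ≤ 1 / a)
  rw [← ENNReal.rpow_mul] at this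
  convert this using 2
  field_simp

end Minkowski

/-! ### Point evaluation in `L^p(S)` and centering at points. -/

section Evaluation

variable {S : Type*} [MeasurableSpace S] {μ : Measure S} {p : ℝ≥0∞} [Fact (1 ≤ p)]

/-- Summable distances give almost everywhere convergence of the whole sequence, without passing to
a subsequence. A subsequence serves only to identify the limit as `η`. -/
theorem ae_tendsto_of_edist_lt_geometric {g : ℕ → Lp ℝ p μ} {η : Lp ℝ p μ}
    (h : ∀ n, edist (g n) η < 2⁻¹ ^ n) :
    ∀ᵐ s ∂μ, Tendsto (fun n => g n s) atTop (𝓝 (η s)) := by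
  have hg : Tendsto g atTop (𝓝 η) := by
    rw [tendsto_iff_edist_tendsto_0]
    refine tendsto_of_tendsto_of_tendsto_of_le_of_le tendsto_const_nhds
      (ENNReal.tendsto_pow_atTop_nhds_zero_of_lt_one (r := 2⁻¹) (by simp))
      (fun n => zero_le) (fun n => (h n).le)
  obtain ⟨φ, hφ, hsub⟩ := (tendstoInMeasure_of_tendsto_Lp hg).exists_seq_tendsto_ae
  have hB : ∑' n : ℕ, (2 * 2⁻¹ ^ n : ℝ≥0∞) ≠ ∞ := by
    rw [ENNReal.tsum_mul_left, ENNReal.tsum_geometric, ENNReal.one_sub_inv_two, inv_inv]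
    simp [ENNReal.mul_eq_top]
  have hcauchy : ∀ N n m : ℕ, N ≤ n → N ≤ m →
      eLpNorm ((g n : S → ℝ) - (g m : S → ℝ)) p μ < 2 * 2⁻¹ ^ N := by
    intro N n m hn hm
    rw [← Lp.edist_def, two_mul]
    have mono : ∀ {k}, N ≤ k → (2⁻¹ : ℝ≥0∞) ^ k ≤ 2⁻¹ ^ N := fun hk =>
      pow_le_pow_right_of_le_one' (by simp) hk
    refine (edist_triangle_right _ _ η).trans_lt ?_
    exact ENNReal.add_lt_add ((h n).trans_le (mono hn)) ((h m).trans_le (mono hm))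
  have hlim := Lp.ae_tendsto_of_cauchy_eLpNorm (f := fun n => (g n : S → ℝ))
    (fun n => Lp.aestronglyMeasurable _) Fact.out hB hcauchy
  filter_upwards [hsub, hlim] with s hs ⟨l, hl⟩
  rwa [tendsto_nhds_unique hs (hl.comp hφ.tendsto_atTop)]

/-- On a separable subset of `L^p(S)` point evaluations can be chosen jointly measurably. -/
theorem exists_measurable_evaluation {t : Set (Lp ℝ p μ)} (ht : TopologicalSpace.IsSeparable t) :
    ∃ Φ : S × Lp ℝ p μ → ℝ, Measurable Φ ∧
      ∀ η ∈ t, (η : S → ℝ) =ᵐ[μ] fun s => Φ (s, η) := by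
  classical
  obtain ⟨c, hc, htc⟩ := ht
  rcases c.eq_empty_or_nonempty with rfl | hne
  · refine ⟨0, measurable_const, fun η hη => ?_⟩
    simpa using htc hη
  obtain ⟨d, rfl⟩ := hc.exists_eq_range hne
  -- The second alternative makes the search for an index total when no `d j` is close to `η`; on
  -- `t` the first alternative always holds by density.
  let near : ℕ → Lp ℝ p μ → ℕ → Prop := fun n η k =>
    edist (d k) η < 2⁻¹ ^ n ∨ ∀ j, ¬ edist (d j) η < 2⁻¹ ^ n
  have hnear : ∀ n η, ∃ k, near n η k := by
    intro n η
    by_cases h : ∃ k, edist (d k) η < 2⁻¹ ^ n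
    · exact h.imp fun k hk => Or.inl hk
    · exact ⟨0, Or.inr (by push Not at h; simpa using h)⟩
  have hopen : ∀ n k, MeasurableSet {η : Lp ℝ p μ | edist (d k) η < 2⁻¹ ^ n} := fun n k =>
    (isOpen_lt (by fun_prop) continuous_const).measurableSet
  have hidx : ∀ n, Measurable fun η => Nat.find (hnear n η) := by
    intro n
    refine measurable_find (hnear n) fun k => ?_
    have : {η | near n η k} = {η : Lp ℝ p μ | edist (d k) η < 2⁻¹ ^ n} ∪
        ⋂ j, {η : Lp ℝ p μ | edist (d j) η < 2⁻¹ ^ n}ᶜ := by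
      ext η; simp [near]
    rw [this]
    exact (hopen n k).union (MeasurableSet.iInter fun j => (hopen n j).compl)
  have hd : Measurable fun x : S × ℕ => d x.2 x.1 :=
    measurable_from_prod_countable_left fun k => (Lp.stronglyMeasurable (d k)).measurable
  -- The limsup is measurable and defined everywhere; on `t` it is an almost everywhere limit.
  refine ⟨fun x => limsup (fun n => d (Nat.find (hnear n x.2)) x.1) atTop,
    Measurable.limsup fun n => hd.comp
      (measurable_fst.prodMk ((hidx n).comp measurable_snd)), fun η hη => ?_⟩
  have hclose : ∀ n, edist (d (Nat.find (hnear n η))) η < 2⁻¹ ^ n := by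
    intro n
    rcases Nat.find_spec (hnear n η) with h | h
    · exact h
    · obtain ⟨_, ⟨k, rfl⟩, hk⟩ := EMetric.mem_closure_iff.1 (htc hη) (2⁻¹ ^ n)
        (by exact pos_iff_ne_zero.2 (pow_ne_zero _ (by simp)))
      exact absurd (edist_comm η (d k) ▸ hk) (h k)
  filter_upwards [ae_tendsto_of_edist_lt_geometric hclose] with s hs
  exact hs.limsup_eq.symm

/-- Hölder's inequality on a set of finite measure. It makes `g ↦ ∫ s in B, g s ∂μ` a bounded
functional on `L^p(S)`, which therefore commutes with the Bochner integral. -/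
theorem exists_setIntegral_norm_le (B : Set S) (hμB : μ B < ∞) :
    ∃ C : ℝ, ∀ g : Lp ℝ p μ, IntegrableOn g B μ ∧ ∫ s in B, ‖g s‖ ∂μ ≤ C * ‖g‖ := by
  have hp1 : (1 : ℝ≥0∞) ≤ p := Fact.out
  set e : ℝ := 1 / (1 : ℝ≥0∞).toReal - 1 / p.toReal with he
  have he0 : 0 ≤ e := by
    rcases eq_or_ne p ∞ with h | h
    · simp [he, h]
    · have : 1 ≤ p.toReal := by simpa using ENNReal.toReal_mono h hp1
      have := (div_le_one (by linarith)).2 this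
      simp only [he, ENNReal.toReal_one, div_one]
      linarith
  have hfin : (μ.restrict B Set.univ) ^ e ≠ ∞ :=
    ENNReal.rpow_ne_top_of_nonneg he0 (by simpa using hμB.ne)
  refine ⟨((μ.restrict B Set.univ) ^ e).toReal, fun g => ?_⟩
  have hle : eLpNorm g 1 (μ.restrict B) ≤ ‖g‖ₑ * (μ.restrict B Set.univ) ^ e := by
    refine (eLpNorm_le_eLpNorm_mul_rpow_measure_univ hp1
      (Lp.aestronglyMeasurable g).restrict).trans ?_
    gcongr
    rw [Lp.enorm_def]
    exact eLpNorm_mono_measure _ Measure.restrict_le_self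
  have hlt : ‖g‖ₑ * (μ.restrict B Set.univ) ^ e ≠ ∞ := ENNReal.mul_ne_top enorm_ne_top hfin
  refine ⟨memLp_one_iff_integrable.1 ⟨(Lp.aestronglyMeasurable g).restrict,
    hle.trans_lt (lt_top_iff_ne_top.2 hlt)⟩, ?_⟩
  rw [integral_norm_eq_lintegral_enorm (Lp.aestronglyMeasurable g).restrict,
    ← eLpNorm_one_eq_lintegral_enorm]
  refine (ENNReal.toReal_mono hlt hle).trans_eq ?_
  rw [ENNReal.toReal_mul, toReal_enorm, mul_comm]

/-- A jointly measurable version of a centered `L^p(S)`-valued random variable is centered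
at almost every point. -/
theorem ae_integral_version_eq_zero [SigmaFinite μ] {Ω : Type*} [MeasurableSpace Ω]
    {P : Measure Ω} [SFinite P] {Y : Ω → Lp ℝ p μ} {f : S × Ω → ℝ} (hf : IsVersion P Y f)
    (hY : Integrable Y P) (h0 : ∫ ω, Y ω ∂P = 0) :
    ∀ᵐ s ∂μ, ∫ ω, f (s, ω) ∂P = 0 := by
  have hprod : ∀ B : Set S, μ B < ∞ → Integrable f ((μ.restrict B).prod P) := by
    intro B hB
    obtain ⟨C, hC⟩ := exists_setIntegral_norm_le (p := p) B hB
    rw [integrable_prod_iff' hf.1.aestronglyMeasurable]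
    constructor
    · filter_upwards [hf.2] with ω hω
      exact (hC (Y ω)).1.congr (ae_restrict_of_ae hω)
    · refine (hY.norm.const_mul C).mono'
        (hf.1.norm.stronglyMeasurable.integral_prod_left').aestronglyMeasurable ?_
      filter_upwards [hf.2] with ω hω
      rw [Real.norm_of_nonneg (integral_nonneg fun s => norm_nonneg _)]
      refine le_of_eq_of_le ?_ (hC (Y ω)).2
      refine integral_congr_ae (ae_restrict_of_ae ?_)
      filter_upwards [hω] with s hs
      rw [hs]
  -- It suffices to integrate the pointwise mean over sets `B` of finite measure; Fubini turns that
  -- integral into `E[T Y] = T E[Y] = 0`.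
  refine ae_eq_zero_of_forall_setIntegral_eq_of_sigmaFinite
    (fun B _ hB => (hprod B hB).integral_prod_left) fun B _ hB => ?_
  obtain ⟨C, hC⟩ := exists_setIntegral_norm_le (p := p) B hB
  let T : Lp ℝ p μ →L[ℝ] ℝ := LinearMap.mkContinuous
    { toFun := fun g => ∫ s in B, g s ∂μ
      map_add' := fun g h => by
        rw [← integral_add (hC g).1 (hC h).1]
        exact integral_congr_ae (ae_restrict_of_ae (Lp.coeFn_add g h))
      map_smul' := fun c g => by
        rw [RingHom.id_apply, ← integral_smul]
        exact integral_congr_ae (ae_restrict_of_ae (Lp.coeFn_smul c g)) }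
    C fun g => (norm_integral_le_integral_norm _).trans (hC g).2
  rw [integral_integral_swap (f := fun s ω => f (s, ω)) (hprod B hB)]
  calc ∫ ω, ∫ s in B, f (s, ω) ∂μ ∂P = ∫ ω, T (Y ω) ∂P := by
        refine integral_congr_ae ?_
        filter_upwards [hf.2] with ω hω
        exact (integral_congr_ae (ae_restrict_of_ae hω)).symm
    _ = 0 := by rw [T.integral_comp_comm hY, h0, map_zero]

end Evaluation

/-! ### The Monte Carlo rate in `L^p(S)`. -/

section MonteCarlo

variable {S : Type*} [MeasurableSpace S] {μ : Measure S} [SigmaFinite μ]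
  {Ω : Type*} [MeasurableSpace Ω] {P : Measure Ω} [IsProbabilityMeasure P]
  {p : ℝ≥0∞} [Fact (1 ≤ p)]

/-- Each assumption on the exponents has its role: `p ≤ q` for Minkowski, `q ≤ r` for the inclusion
of `L^r(Ω)` in `L^q(Ω)`, and `1 < r ≤ 2` for von Bahr–Esseen at each point. -/
theorem eLpNorm_sum_le_mixedNorm_of_measurable {q r : ℝ} (hq : 1 < q) (hqr : q ≤ r) (hr : r ≤ 2)
    (hp : p ≤ ENNReal.ofReal q) {η : Ω → Lp ℝ p μ} {Y : ℕ → Ω → Lp ℝ p μ}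
    (hη : Measurable η) (hηs : AEStronglyMeasurable η P) (hYm : ∀ j, Measurable (Y j))
    (hind : iIndepFun Y P) (hY : ∀ j, MemLp (Y j) (ENNReal.ofReal q) P)
    (hid : ∀ j, IdentDistrib (Y j) η P P) (h0 : ∫ ω, η ω ∂P = 0) {n : ℕ} (hn : 1 ≤ n) :
    eLpNorm (fun ω => ∑ j ∈ Finset.range n, Y j ω) (ENNReal.ofReal q) P
      ≤ ENNReal.ofReal ((4 * n) ^ r⁻¹) * mixedNorm P (ENNReal.ofReal r) η := by
  have hp1 : (1 : ℝ≥0∞) ≤ p := Fact.out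
  have hq1 : (1 : ℝ≥0∞) ≤ ENNReal.ofReal q := hp1.trans hp
  obtain ⟨t₀, ht₀, hηt⟩ := hηs.isSeparable_ae_range
  choose t ht hYt using fun j => (hY j).aestronglyMeasurable.isSeparable_ae_range
  -- One `Φ` serves `η` and all `Y j`. For fixed `s` the same measurable function `Φ (s, ·)` is
  -- applied to each of them, so independence and equality of laws persist.
  obtain ⟨Φ, hΦ, hΦt⟩ := exists_measurable_evaluation
    (ht₀.union (TopologicalSpace.IsSeparable.iUnion ht))
  have hver : ∀ j, IsVersion P (Y j) fun x => Φ (x.1, Y j x.2) := by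
    refine fun j => ⟨hΦ.comp (measurable_fst.prodMk ((hYm j).comp measurable_snd)), ?_⟩
    filter_upwards [hYt j] with ω hω
    exact hΦt _ (Or.inr (Set.mem_iUnion.2 ⟨j, hω⟩))
  have hsec : ∀ s, Measurable fun y => Φ (s, y) := fun s => hΦ.comp measurable_prodMk_left
  set c : S → ℝ≥0∞ := fun s => eLpNorm (fun ω => Φ (s, η ω)) (ENNReal.ofReal r) P
  have hcj : ∀ s j, eLpNorm (fun ω => Φ (s, Y j ω)) (ENNReal.ofReal r) P = c s := fun s j =>
    ((hid j).comp (hsec s)).eLpNorm_eq _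
  have hcent : ∀ᵐ s ∂μ, ∀ j, ∫ ω, Φ (s, Y j ω) ∂P = 0 := by
    rw [ae_all_iff]
    exact fun j => ae_integral_version_eq_zero (hver j) ((hY j).integrable hq1)
      ((hid j).integral_eq.trans h0)
  set G : S × Ω → ℝ := fun x => ∑ j ∈ Finset.range n, Φ (x.1, Y j x.2)
  have hG : Measurable G := Finset.measurable_fun_sum _ fun j _ => (hver j).1
  have hGY : ∀ᵐ ω ∂P, ‖∑ j ∈ Finset.range n, Y j ω‖ₑ = ‖eLpNorm (fun s => G (s, ω)) p μ‖ₑ := by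
    filter_upwards [ae_all_iff.2 fun j => (hver j).2] with ω hω
    rw [Lp.enorm_def, enorm_eq_self]
    refine eLpNorm_congr_ae ?_
    filter_upwards [Lp.coeFn_finsetSum (Finset.range n) fun j => Y j ω, ae_all_iff.2 hω] with s h1 h2
    rw [h1, Finset.sum_apply]
    exact Finset.sum_congr rfl fun j _ => h2 j
  have hnorm := eLpNorm_congr_enorm_ae (p := ENNReal.ofReal q) hGY
  have hfin : eLpNorm (fun ω => ∑ j ∈ Finset.range n, Y j ω) (ENNReal.ofReal q) P ≠ ∞ :=
    (memLp_finsetSum _ fun j _ => hY j).2.ne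
  rw [hnorm] at hfin ⊢
  have hpoint : ∀ᵐ s ∂μ, ‖eLpNorm (fun ω => G (s, ω)) (ENNReal.ofReal q) P‖ₑ
      ≤ ((4 * n : ℝ) ^ r⁻¹).toNNReal * ‖c s‖ₑ := by
    filter_upwards [hcent] with s hs
    rw [enorm_eq_self, enorm_eq_self]
    refine (eLpNorm_le_eLpNorm_of_exponent_le (ENNReal.ofReal_le_ofReal hqr)
      (hG.comp measurable_prodMk_left).aestronglyMeasurable).trans ?_
    exact eLpNorm_sum_le_of_iIndepFun (hq.trans_le hqr) hr
      (hind.comp (fun _ y => Φ (s, y)) fun _ => hsec s)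
      (fun j => ((hsec s).comp (hYm j)).aestronglyMeasurable) hs (hcj s) hn
  refine (eLpNorm_eLpNorm_swap_le (zero_lt_one.trans_le hp1).ne' hp ENNReal.ofReal_ne_top hG
    hfin).trans ((eLpNorm_le_nnreal_smul_eLpNorm_of_ae_le_mul' hpoint p).trans ?_)
  change ENNReal.ofReal ((4 * n) ^ r⁻¹) * eLpNorm c p μ ≤ _
  gcongr
  -- Every version `f` of `η` agrees with `Φ (s, η ω)` almost everywhere, first in `s` for almost
  -- every `ω`, then with the quantifiers exchanged. The exchange needs a measurable set, hence a
  -- strictly measurable `η`.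
  refine le_iInf₂ fun f hf => le_of_eq ?_
  refine eLpNorm_congr_ae ?_
  have hset : MeasurableSet {x : S × Ω | f (x.1, x.2) = Φ (x.1, η x.2)} :=
    measurableSet_eq_fun hf.1 (hΦ.comp (measurable_fst.prodMk (hη.comp measurable_snd)))
  have hae : ∀ᵐ s ∂μ, ∀ᵐ ω ∂P, f (s, ω) = Φ (s, η ω) := by
    rw [Measure.ae_ae_comm hset]
    filter_upwards [hf.2, hηt] with ω h1 h2
    filter_upwards [h1, hΦt _ (Or.inl h2)] with s h3 h4
    rw [← h3, h4]
  filter_upwards [hae] with s hs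
  exact eLpNorm_congr_ae (hs.mono fun ω h => h.symm)

/-- Monte Carlo rate for independent copies of a centered random variable in `L^p(S; L^r(Ω))`. -/
theorem eLpNorm_sum_le_mixedNorm {q r : ℝ} (hq : 1 < q) (hqr : q ≤ r) (hr : r ≤ 2)
    (hp : p ≤ ENNReal.ofReal q) {η : Ω → Lp ℝ p μ} {Y : ℕ → Ω → Lp ℝ p μ}
    (hη : AEStronglyMeasurable η P)
    (hind : iIndepFun Y P) (hY : ∀ j, MemLp (Y j) (ENNReal.ofReal q) P)
    (hid : ∀ j, IdentDistrib (Y j) η P P) (h0 : ∫ ω, η ω ∂P = 0) {n : ℕ} (hn : 1 ≤ n) :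
    eLpNorm (fun ω => ∑ j ∈ Finset.range n, Y j ω) (ENNReal.ofReal q) P
      ≤ ENNReal.ofReal ((4 * n) ^ r⁻¹) * mixedNorm P (ENNReal.ofReal r) η := by
  have hYm := fun j => (hY j).aestronglyMeasurable
  have hmix : mixedNorm P (ENNReal.ofReal r) (hη.mk η) = mixedNorm P (ENNReal.ofReal r) η := by
    have hiff : ∀ f : S × Ω → ℝ, IsVersion P (hη.mk η) f ↔ IsVersion P η f := by
      refine fun f => and_congr_right fun _ => eventually_congr ?_
      filter_upwards [hη.ae_eq_mk] with ω hω
      rw [hω]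
    simp only [mixedNorm, hiff]
  have hsum : eLpNorm (fun ω => ∑ j ∈ Finset.range n, Y j ω) (ENNReal.ofReal q) P
      = eLpNorm (fun ω => ∑ j ∈ Finset.range n, (hYm j).mk (Y j) ω) (ENNReal.ofReal q) P := by
    refine eLpNorm_congr_ae ?_
    filter_upwards [ae_all_iff.2 fun j => (hYm j).ae_eq_mk] with ω hω
    exact Finset.sum_congr rfl fun j _ => hω j
  rw [hsum, ← hmix]
  refine eLpNorm_sum_le_mixedNorm_of_measurable hq hqr hr hp hη.stronglyMeasurable_mk.measurable
    hη.stronglyMeasurable_mk.aestronglyMeasurable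
    (fun j => (hYm j).stronglyMeasurable_mk.measurable)
    (hind.congr fun j => (hYm j).ae_eq_mk) (fun j => (hY j).ae_eq (hYm j).ae_eq_mk)
    (fun j => ?_) ((integral_congr_ae hη.ae_eq_mk).symm.trans h0) hn
  exact ((IdentDistrib.of_ae_eq (hid j).aemeasurable_fst (hYm j).ae_eq_mk).symm.trans
    (hid j)).trans (IdentDistrib.of_ae_eq (hid j).aemeasurable_snd hη.ae_eq_mk)

end MonteCarlo

/-! ### Comparison of cost bounds as functions of the conjugate exponent. -/

section Comparison

theorem logb_two_le_abs_logb {A ε : ℝ} (hA : 1 < A) (hε : ε ∈ Set.Ioc (0 : ℝ) (1 / 2)) :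
    Real.logb A 2 ≤ |Real.logb A ε| := by
  have h : Real.logb A ε ≤ -Real.logb A 2 := by
    rw [← Real.logb_inv]
    exact Real.logb_le_logb_of_le hA hε.1 (by simpa using hε.2)
  exact (le_neg_of_le_neg h).trans (neg_le_abs _)

theorem abs_logb_rpow_le {A w κ : ℝ} (hA : 1 < A) (hw : 0 < w) (hκ : 0 < κ) :
    ∃ C : ℝ, 0 < C ∧ ∀ ε ∈ Set.Ioc (0 : ℝ) (1 / 2), |Real.logb A ε| ^ w ≤ C * ε ^ (-κ) := by
  have hs : 0 < κ / w := by positivity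
  have hlA : 0 < Real.log A := Real.log_pos hA
  refine ⟨(1 / (κ / w * Real.log A)) ^ w, by positivity, fun ε hε => ?_⟩
  have hε0 : 0 < ε := hε.1
  have habs : |Real.logb A ε| = Real.log ε⁻¹ / Real.log A := by
    rw [Real.logb, abs_div, abs_of_pos hlA, Real.log_inv,
      abs_of_nonpos (Real.log_nonpos hε0.le (by linarith [hε.2]))]
  have hle : |Real.logb A ε| ≤ 1 / (κ / w * Real.log A) * ε ^ (-(κ / w)) := by
    rw [habs, div_le_iff₀ hlA]
    have := Real.log_le_rpow_div (inv_nonneg.2 hε0.le) hs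
    rw [Real.inv_rpow hε0.le, ← Real.rpow_neg hε0.le] at this
    refine this.trans_eq ?_
    field_simp
  calc |Real.logb A ε| ^ w ≤ (1 / (κ / w * Real.log A) * ε ^ (-(κ / w))) ^ w :=
        Real.rpow_le_rpow (abs_nonneg _) hle hw.le
    _ = _ := by
        rw [Real.mul_rpow (by positivity) (by positivity), ← Real.rpow_mul hε0.le]
        congr 2
        field_simp

theorem rpow_neg_le_rpow_neg {ε u v : ℝ} (hε : ε ∈ Set.Ioc (0 : ℝ) (1 / 2)) (huv : u ≤ v) :
    ε ^ (-u) ≤ ε ^ (-v) :=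
  Real.rpow_le_rpow_of_exponent_ge hε.1 (by linarith [hε.2]) (by linarith)

/-- The sampling part of the cost bound in terms of `x = r'`, `g = γ + b₁` and `h = b₀ + b₁`. -/
noncomputable def samplingBound (α g h A x ε : ℝ) : ℝ :=
  if g / h < x then ε ^ (-x)
  else if g / h = x then ε ^ (-x) * |Real.logb A ε| ^ (x + 1)
  else ε ^ (-x - (g - h * x) / α)

/-- The polynomial order of `samplingBound`. -/
noncomputable def samplingOrder (α g h x : ℝ) : ℝ := x + max 0 ((g - h * x) / α)

variable {α g h A x : ℝ}

theorem samplingOrder_of_le (hα : 0 < α) (hh : 0 < h) (hx : g / h ≤ x) :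
    samplingOrder α g h x = x := by
  have : g ≤ h * x := by rwa [div_le_iff₀' hh] at hx
  rw [samplingOrder, max_eq_left (div_nonpos_of_nonpos_of_nonneg (by linarith) hα.le), add_zero]

theorem samplingOrder_of_ge (hα : 0 < α) (hh : 0 < h) (hx : x ≤ g / h) :
    samplingOrder α g h x = x + (g - h * x) / α := by
  have : h * x ≤ g := by rwa [le_div_iff₀' hh] at hx
  rw [samplingOrder, max_eq_right (div_nonneg (by linarith) hα.le)]

theorem samplingBound_of_ne (hα : 0 < α) (hh : 0 < h) (hx : x ≠ g / h) (ε : ℝ) :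
    samplingBound α g h A x ε = ε ^ (-samplingOrder α g h x) := by
  rcases hx.lt_or_gt with hlt | hgt
  · rw [samplingBound, if_neg hlt.not_gt, if_neg hlt.ne', samplingOrder_of_ge hα hh hlt.le]
    ring_nf
  · rw [samplingBound, if_pos hgt, samplingOrder_of_le hα hh hgt.le]

/-- Only the logarithmic case costs a constant: `ε ≤ 1/2` keeps `|log_A ε|` above `log_A 2 > 0`. -/
theorem rpow_samplingOrder_le (hα : 0 < α) (hh : 0 < h) (hA : 1 < A) (hx : 0 < x) :
    ∃ C : ℝ, 0 < C ∧ ∀ ε ∈ Set.Ioc (0 : ℝ) (1 / 2),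
      ε ^ (-samplingOrder α g h x) ≤ C * samplingBound α g h A x ε := by
  by_cases hne : x = g / h
  · have hl : 0 < Real.logb A 2 := Real.logb_pos hA one_lt_two
    refine ⟨(Real.logb A 2 ^ (x + 1))⁻¹, by positivity, fun ε hε => ?_⟩
    rw [samplingBound, if_neg (by rw [hne]; exact lt_irrefl _), if_pos hne.symm,
      samplingOrder_of_le hα hh hne.ge, mul_left_comm]
    refine le_mul_of_one_le_right (Real.rpow_nonneg hε.1.le _) ?_
    rw [← div_eq_inv_mul, one_le_div (by positivity)]
    exact Real.rpow_le_rpow hl.le (logb_two_le_abs_logb hA hε) (by linarith)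
  · exact ⟨1, one_pos, fun ε _ => by rw [samplingBound_of_ne hα hh hne, one_mul]⟩

/-- Away from the kink the bound is a pure power; at the kink `x = g / h` the logarithm is absorbed
by the strict gap in the exponent. -/
theorem samplingBound_le_rpow (hα : 0 < α) (hh : 0 < h) (hA : 1 < A) (hx : 0 < x) {v : ℝ}
    (hv : samplingOrder α g h x < v ∨ (x ≠ g / h ∧ samplingOrder α g h x ≤ v)) :
    ∃ C : ℝ, 0 < C ∧ ∀ ε ∈ Set.Ioc (0 : ℝ) (1 / 2),
      samplingBound α g h A x ε ≤ C * ε ^ (-v) := by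
  by_cases hne : x = g / h
  · have hv' : x < v := by
      rw [samplingOrder_of_le hα hh hne.ge] at hv
      exact hv.elim id fun h' => absurd hne h'.1
    obtain ⟨C, hC, hle⟩ := abs_logb_rpow_le hA (by linarith : 0 < x + 1) (sub_pos.2 hv')
    refine ⟨C, hC, fun ε hε => ?_⟩
    rw [samplingBound, if_neg (by rw [hne]; exact lt_irrefl _), if_pos hne.symm]
    calc ε ^ (-x) * |Real.logb A ε| ^ (x + 1) ≤ ε ^ (-x) * (C * ε ^ (-(v - x))) :=
          mul_le_mul_of_nonneg_left (hle ε hε) (Real.rpow_nonneg hε.1.le _)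
      _ = C * ε ^ (-v) := by
          rw [mul_left_comm, ← Real.rpow_add hε.1]
          ring_nf
  · refine ⟨1, one_pos, fun ε hε => ?_⟩
    rw [samplingBound_of_ne hα hh hne, one_mul]
    exact rpow_neg_le_rpow_neg hε (hv.elim le_of_lt And.right)

theorem samplingBound_nonneg {ε : ℝ} (hε : 0 < ε) : 0 ≤ samplingBound α g h A x ε := by
  unfold samplingBound
  split_ifs <;> positivity

/-- The sampling bound at `x` is dominated by the one at `y` if its order is smaller, where a
logarithmic factor requires a strictly smaller order. -/
theorem samplingBound_le_samplingBound (hα : 0 < α) (hh : 0 < h) (hA : 1 < A) {y : ℝ} (hx : 0 < x)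
    (hy : 0 < y) (hxy : x = y ∨ samplingOrder α g h x < samplingOrder α g h y ∨
      (x ≠ g / h ∧ samplingOrder α g h x ≤ samplingOrder α g h y)) :
    ∃ C : ℝ, 0 < C ∧ ∀ ε ∈ Set.Ioc (0 : ℝ) (1 / 2),
      samplingBound α g h A x ε ≤ C * samplingBound α g h A y ε := by
  rcases hxy with rfl | hxy
  · exact ⟨1, one_pos, fun ε _ => (one_mul _).ge⟩
  obtain ⟨C₁, hC₁, h₁⟩ := samplingBound_le_rpow hα hh hA hx hxy
  obtain ⟨C₂, hC₂, h₂⟩ := rpow_samplingOrder_le (g := g) hα hh hA hy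
  refine ⟨C₁ * C₂, by positivity, fun ε hε => (h₁ ε hε).trans ?_⟩
  rw [mul_assoc]
  exact mul_le_mul_of_nonneg_left (h₂ ε hε) hC₁.le

end Comparison

/-! ### Minimization over the exponent `r`. -/

section Optimality

variable {q qh α γ b₀ b₁ A : ℝ} {β : ℝ → ℝ}

/-- Since `1 / r = 1 - 1 / x` for `x = r'`, the product `β(r) x = (b₀ + b₁) x - b₁` is affine in
`x`. Comparing `β(r)` with `γ / r'` thus amounts to comparing `x` with `t`. -/
theorem costBound_eq_add_samplingBound {r : ℝ} (hr : 1 < r) (hb : 0 < b₀ + b₁)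
    (hβ : β r = b₀ + b₁ / r) (ε : ℝ) :
    costBound α γ β A r ε = ε ^ (-(γ / α)) +
      samplingBound α (γ + b₁) (b₀ + b₁) A (Real.conjExponent r) ε := by
  have hc : r.HolderConjugate (Real.conjExponent r) := .conjExponent hr
  set x := Real.conjExponent r with hx
  have hx0 : 0 < x := hc.symm.pos
  have hinv : 1 / r = 1 - 1 / x := by
    have := hc.inv_add_inv_eq_one
    rw [one_div, one_div]; linarith
  have hβx : β r * x = (b₀ + b₁) * x - b₁ := by
    rw [hβ, div_eq_mul_one_div, hinv]
    field_simp
    ring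
  have hlt : γ / x < β r ↔ (γ + b₁) / (b₀ + b₁) < x := by
    rw [div_lt_iff₀ hx0, hβx, div_lt_iff₀ hb, lt_sub_iff_add_lt, mul_comm x]
  have heq : β r = γ / x ↔ (γ + b₁) / (b₀ + b₁) = x := by
    rw [eq_div_iff hx0.ne', hβx, div_eq_iff hb.ne', sub_eq_iff_eq_add, mul_comm x, eq_comm]
  have hsub : γ - β r * x = γ + b₁ - (b₀ + b₁) * x := by rw [hβx]; ring
  simp only [costBound, samplingBound, ← hx, hlt, heq, hsub]
  split_ifs <;> rfl

/-- The value of `r'` at which the optimal bound is attained. -/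
noncomputable def optimalConj (q qh α γ b₀ b₁ : ℝ) : ℝ :=
  if (γ + b₁) / (b₀ + b₁) ≤ Real.conjExponent qh ∨ b₀ + b₁ ≤ α then Real.conjExponent qh
  else min ((γ + b₁) / (b₀ + b₁)) (Real.conjExponent q)

theorem optimalCostBound_eq_add_samplingBound (ε : ℝ) :
    optimalCostBound q qh α γ b₀ b₁ A ε = ε ^ (-(γ / α)) +
      samplingBound α (γ + b₁) (b₀ + b₁) A (optimalConj q qh α γ b₀ b₁) ε := by
  simp only [optimalCostBound, optimalConj]
  set t := (γ + b₁) / (b₀ + b₁)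
  set y := Real.conjExponent qh
  set z := Real.conjExponent q
  rcases lt_trichotomy t y with h | h | h
  · rw [if_pos h, if_pos (Or.inl h.le), samplingBound, if_pos h]
  · rw [if_neg h.not_lt, if_pos h, if_pos (Or.inl h.le), samplingBound, if_neg h.not_lt, if_pos h]
  · rw [if_neg h.not_gt, if_neg h.ne']
    by_cases hα : b₀ + b₁ ≤ α
    · rw [if_pos hα, if_pos hα, ite_self, if_pos (Or.inr hα), samplingBound, if_neg h.not_gt,
        if_neg h.ne']
    · rw [if_neg hα, if_neg hα, if_neg (not_or.2 ⟨h.not_ge, hα⟩)]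
      by_cases hz : t ≤ z
      · rw [if_pos hz, min_eq_left hz, samplingBound, if_neg (lt_irrefl _), if_pos rfl]
      · push Not at hz
        rw [if_neg hz.not_ge, min_eq_right hz.le, samplingBound, if_neg hz.not_gt, if_neg hz.ne']

theorem conjExponent_anti {r s : ℝ} (hr : 1 < r) (hrs : r ≤ s) :
    Real.conjExponent s ≤ Real.conjExponent r := by
  rw [Real.conjExponent, Real.conjExponent, div_le_div_iff₀ (by linarith) (by linarith)]
  nlinarith

/-- Conjugation is a decreasing involution, so a kink `t` between `qh'` and `q'` is attained at `r =
t'`, which lies in `[q, qh]`. -/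
theorem exists_conjExponent_eq_optimalConj (hq : 1 < q) (hqh : q ≤ qh) :
    ∃ r ∈ Set.Icc q qh, Real.conjExponent r = optimalConj q qh α γ b₀ b₁ := by
  unfold optimalConj
  split_ifs with h
  · exact ⟨qh, ⟨hqh, le_rfl⟩, rfl⟩
  push Not at h
  rcases le_total ((γ + b₁) / (b₀ + b₁)) (Real.conjExponent q) with ht | ht
  · rw [min_eq_left ht]
    set t := (γ + b₁) / (b₀ + b₁)
    have hcq : q.HolderConjugate (Real.conjExponent q) := .conjExponent hq
    have hch : qh.HolderConjugate (Real.conjExponent qh) := .conjExponent (hq.trans_le hqh)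
    have ht1 : 1 < t := hch.symm.lt.trans h.1
    have hct : t.HolderConjugate (Real.conjExponent t) := .conjExponent ht1
    refine ⟨Real.conjExponent t, ⟨?_, ?_⟩, hct.symm.conjugate_eq.symm⟩
    · rw [hcq.symm.conjugate_eq]
      exact conjExponent_anti ht1 ht
    · rw [hch.symm.conjugate_eq]
      exact conjExponent_anti hch.symm.lt h.1.le
  · rw [min_eq_right ht]
    exact ⟨q, ⟨le_rfl, hqh⟩, rfl⟩

/-- As a function of `x` the order has slope `1 - h / α` below `g / h` and slope `1` above. It is
minimal at the left end if the kink lies to the left or if `h ≤ α`; otherwise it decreases up to the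
kink or to `q'`, whichever comes first. At the kink the bound carries a logarithm, so domination of
another `x` there requires strictly smaller order. -/
theorem samplingOrder_optimalConj_le (hα : 0 < α) (hb : 0 < b₀ + b₁) {x : ℝ}
    (hx : x ∈ Set.Icc (Real.conjExponent qh) (Real.conjExponent q)) :
    let g := γ + b₁
    let h := b₀ + b₁
    let x₀ := optimalConj q qh α γ b₀ b₁
    x₀ = x ∨ samplingOrder α g h x₀ < samplingOrder α g h x ∨
      (x₀ ≠ g / h ∧ samplingOrder α g h x₀ ≤ samplingOrder α g h x) := by
  intro g h x₀
  have hle : ∀ y, y ≤ samplingOrder α g h y := fun y =>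
    le_add_of_nonneg_right (le_max_left _ _)
  have hle' : ∀ y, y + (g - h * y) / α ≤ samplingOrder α g h y := fun y =>
    add_le_add_right (le_max_right _ _) _
  have hh : h ≠ 0 := hb.ne'
  rcases lt_trichotomy (g / h) (Real.conjExponent qh) with ht | ht | ht
  · have hx₀ : x₀ = Real.conjExponent qh := if_pos (Or.inl ht.le)
    rw [hx₀, samplingOrder_of_le hα hb ht.le]
    exact Or.inr (Or.inr ⟨ht.ne', hx.1.trans (hle x)⟩)
  · have hx₀ : x₀ = Real.conjExponent qh := if_pos (Or.inl ht.le)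
    rw [hx₀, samplingOrder_of_le hα hb ht.le]
    rcases hx.1.eq_or_lt with h1 | h1
    · exact Or.inl h1
    · exact Or.inr (Or.inl (h1.trans_le (hle x)))
  · by_cases hαb : b₀ + b₁ ≤ α
    · have hx₀ : x₀ = Real.conjExponent qh := if_pos (Or.inr hαb)
      rw [hx₀, samplingOrder_of_ge hα hb ht.le]
      refine Or.inr (Or.inr ⟨ht.ne, le_trans ?_ (hle' x)⟩)
      rw [← sub_nonneg]
      have : x + (g - h * x) / α - (Real.conjExponent qh + (g - h * Real.conjExponent qh) / α)
          = (x - Real.conjExponent qh) * (α - h) / α := by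
        field_simp; ring
      rw [this]
      exact div_nonneg (mul_nonneg (sub_nonneg.2 hx.1) (sub_nonneg.2 hαb)) hα.le
    · have hx₀ : x₀ = min (g / h) (Real.conjExponent q) := if_neg (not_or.2 ⟨ht.not_ge, hαb⟩)
      push Not at hαb
      rcases le_or_gt (g / h) (Real.conjExponent q) with hz | hz
      · rw [hx₀, min_eq_left hz, samplingOrder_of_le hα hb le_rfl]
        rcases lt_trichotomy (g / h) x with h1 | h1 | h1
        · exact Or.inr (Or.inl (h1.trans_le (hle x)))
        · exact Or.inl h1
        · refine Or.inr (Or.inl (lt_of_lt_of_le ?_ (hle' x)))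
          rw [← sub_pos]
          have : x + (g - h * x) / α - g / h = (g / h - x) * (h - α) / α := by
            field_simp; ring
          rw [this]
          exact div_pos (mul_pos (sub_pos.2 h1) (sub_pos.2 hαb)) hα
      · rw [hx₀, min_eq_right hz.le, samplingOrder_of_ge hα hb hz.le]
        refine Or.inr (Or.inr ⟨hz.ne, le_trans ?_ (hle' x)⟩)
        rw [← sub_nonneg]
        have : x + (g - h * x) / α - (Real.conjExponent q + (g - h * Real.conjExponent q) / α)
            = (Real.conjExponent q - x) * (h - α) / α := by
          field_simp; ring
        rw [this]
        exact div_nonneg (mul_nonneg (sub_nonneg.2 hx.2) (sub_pos.2 hαb).le) hα.le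

theorem add_pos_of_rate_pos {r : ℝ} (hr : 1 < r) (hb₁ : 0 < b₁) (hpos : 0 < b₀ + b₁ / r) :
    0 < b₀ + b₁ := by
  have : b₁ / r < b₁ := div_lt_self hb₁ hr
  linarith

theorem exists_optimalCostBound_eq (hq : 1 < q) (hqh : q ≤ qh) (hb₁ : 0 < b₁)
    (hβ : ∀ r ∈ Set.Icc q qh, β r = b₀ + b₁ / r ∧ 0 < b₀ + b₁ / r) :
    ∃ r ∈ Set.Icc q qh, ∀ ε,
      optimalCostBound q qh α γ b₀ b₁ A ε = costBound α γ β A r ε := by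
  obtain ⟨r, hr, hrx⟩ := exists_conjExponent_eq_optimalConj (α := α) (γ := γ) (b₀ := b₀)
    (b₁ := b₁) hq hqh
  have hr1 : 1 < r := hq.trans_le hr.1
  refine ⟨r, hr, fun ε => ?_⟩
  rw [optimalCostBound_eq_add_samplingBound, costBound_eq_add_samplingBound hr1
    (add_pos_of_rate_pos hr1 hb₁ (hβ r hr).2) (hβ r hr).1, hrx]

theorem optimalCostBound_le_costBound (hq : 1 < q) (hqh : q ≤ qh) (hb₁ : 0 < b₁) (hα : 0 < α)
    (hA : 1 < A) (hβ : ∀ r ∈ Set.Icc q qh, β r = b₀ + b₁ / r ∧ 0 < b₀ + b₁ / r)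
    {r : ℝ} (hr : r ∈ Set.Icc q qh) :
    ∃ C : ℝ, 0 < C ∧ ∀ ε ∈ Set.Ioc (0 : ℝ) (1 / 2),
      optimalCostBound q qh α γ b₀ b₁ A ε ≤ C * costBound α γ β A r ε := by
  have hr1 : 1 < r := hq.trans_le hr.1
  have hb : 0 < b₀ + b₁ := add_pos_of_rate_pos hr1 hb₁ (hβ r hr).2
  have hconj : ∀ {s : ℝ}, 1 < s → 0 < Real.conjExponent s := fun hs =>
    (Real.HolderConjugate.conjExponent hs).symm.pos
  obtain ⟨s, hs, hsx⟩ := exists_conjExponent_eq_optimalConj (α := α) (γ := γ) (b₀ := b₀)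
    (b₁ := b₁) hq hqh
  obtain ⟨C, hC, hle⟩ := samplingBound_le_samplingBound (A := A) hα hb hA
    (hsx ▸ hconj (hq.trans_le hs.1)) (hconj hr1)
    (samplingOrder_optimalConj_le (γ := γ) (q := q) (qh := qh) hα hb
      ⟨conjExponent_anti hr1 hr.2, conjExponent_anti hq hr.1⟩)
  refine ⟨C + 1, by linarith, fun ε hε => ?_⟩
  rw [optimalCostBound_eq_add_samplingBound, costBound_eq_add_samplingBound hr1 hb (hβ r hr).1]
  have h1 := hle ε hε
  have h2 : 0 ≤ ε ^ (-(γ / α)) := Real.rpow_nonneg hε.1.le _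
  have h3 := samplingBound_nonneg (α := α) (g := γ + b₁) (h := b₀ + b₁) (A := A)
    (x := Real.conjExponent r) hε.1
  nlinarith

end Optimality

/-! ### Finite geometric sums. -/

section Geometric

theorem sum_Icc_pow_le_of_one_lt {ρ : ℝ} (hρ : 1 < ρ) (L : ℕ) :
    ∑ ℓ ∈ Finset.Icc 1 L, ρ ^ ℓ ≤ ρ / (ρ - 1) * ρ ^ L := by
  have h1 : 0 < ρ - 1 := by linarith
  induction L with
  | zero => simpa using div_nonneg (by linarith) h1.le
  | succ L ih =>
    rw [Finset.sum_Icc_succ_top (by omega)]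
    calc _ ≤ ρ / (ρ - 1) * ρ ^ L + ρ ^ (L + 1) := by gcongr
      _ = _ := by field_simp; ring

theorem sum_Icc_pow_le_of_lt_one {ρ : ℝ} (hρ0 : 0 < ρ) (hρ : ρ < 1) (L : ℕ) :
    ∑ ℓ ∈ Finset.Icc 1 L, ρ ^ ℓ ≤ ρ / (1 - ρ) := by
  have h1 : 0 < 1 - ρ := by linarith
  have key : ∑ ℓ ∈ Finset.Icc 1 L, ρ ^ ℓ + ρ ^ (L + 1) / (1 - ρ) = ρ / (1 - ρ) := by
    induction L with
    | zero => simp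
    | succ L ih =>
      rw [Finset.sum_Icc_succ_top (by omega), ← ih]
      field_simp
      ring
  have : 0 ≤ ρ ^ (L + 1) / (1 - ρ) := by positivity
  linarith

end Geometric

/-! ### Choice of levels and sample numbers for a fixed exponent. -/

section Numerics

variable {A : ℝ}

/-- There is a level `L` at which `A ^ L` has the order of magnitude of `ε ^ (-1 / α)`. -/
theorem exists_level {α K₁ : ℝ} (hα : 0 < α) (hA : 1 < A) (hK₁ : 1 ≤ K₁) {ε : ℝ}
    (hε : ε ∈ Set.Ioc (0 : ℝ) (1 / 2)) :
    ∃ L : ℕ, 1 ≤ L ∧ K₁ * ε ^ (-(1 / α)) ≤ A ^ L ∧ A ^ L ≤ A * K₁ * ε ^ (-(1 / α)) := by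
  have hε1 : 1 ≤ ε ^ (-(1 / α)) :=
    Real.one_le_rpow_of_pos_of_le_one_of_nonpos hε.1 (by linarith [hε.2])
      (neg_nonpos.2 (by positivity))
  -- The target lies between `A ^ n` and `A ^ (n + 1)`; taking `L = n + 1` overshoots by at most a
  -- factor `A` and ensures `1 ≤ L`.
  obtain ⟨n, h1, h2⟩ := exists_nat_pow_near (one_le_mul_of_one_le_of_one_le hK₁ hε1) hA
  refine ⟨n + 1, by omega, h2.le, ?_⟩
  rw [pow_succ', mul_assoc]
  gcongr

/-- The additive constant `log_A K` is absorbed because `|log_A ε|` is bounded below on `(0, 1/2]`.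
-/
theorem level_le_abs_logb {α K : ℝ} (hα : 0 < α) (hA : 1 < A) (hK : 0 < K) :
    ∃ C : ℝ, 0 < C ∧ ∀ ε ∈ Set.Ioc (0 : ℝ) (1 / 2), ∀ L : ℕ, A ^ L ≤ K * ε ^ (-(1 / α)) →
      (L : ℝ) ≤ C * |Real.logb A ε| := by
  have hl : 0 < Real.logb A 2 := Real.logb_pos hA one_lt_two
  refine ⟨|Real.logb A K| / Real.logb A 2 + 1 / α, by positivity, fun ε hε L hL => ?_⟩
  have hlog := Real.logb_le_logb_of_le hA (by positivity) hL
  rw [Real.logb_pow, Real.logb_self_eq_one hA, mul_one, Real.logb_mul hK.ne'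
    (Real.rpow_pos_of_pos hε.1 _).ne', Real.logb_rpow_eq_mul_logb_of_pos hε.1] at hlog
  have h1 : |Real.logb A K| ≤ |Real.logb A K| / Real.logb A 2 * |Real.logb A ε| := by
    rw [div_mul_eq_mul_div, le_div_iff₀ hl]
    exact mul_le_mul_of_nonneg_left (logb_two_le_abs_logb hA hε) (abs_nonneg _)
  have h2 : -(1 / α) * Real.logb A ε ≤ 1 / α * |Real.logb A ε| := by
    rw [neg_mul, ← mul_neg]
    exact mul_le_mul_of_nonneg_left (neg_le_abs _) (by positivity)
  have h3 := le_abs_self (Real.logb A K)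
  linarith

theorem level_rpow_le {α K a : ℝ} (hA : 1 < A) (hK : 0 < K) (ha : 0 ≤ a) {ε : ℝ}
    (hε : 0 < ε) {L : ℕ} (hL : A ^ L ≤ K * ε ^ (-(1 / α))) :
    (A ^ a) ^ L ≤ K ^ a * ε ^ (-(a / α)) := by
  have hA0 : 0 < A := by linarith
  calc (A ^ a) ^ L = (A ^ L) ^ a := by
        rw [← Real.rpow_natCast, ← Real.rpow_natCast, ← Real.rpow_mul hA0.le,
          ← Real.rpow_mul hA0.le, mul_comm]
    _ ≤ (K * ε ^ (-(1 / α))) ^ a := Real.rpow_le_rpow (by positivity) hL ha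
    _ = _ := by
        rw [Real.mul_rpow hK.le (by positivity), ← Real.rpow_mul hε.le]
        congr 2
        ring

/-- Cost of an optimal distribution of the samples: the weights on the levels are geometric with
ratio `A ^ δ`. -/
theorem weighted_geometric_cost_le {α γ b x K : ℝ} (hα : 0 < α) (hγ : 0 < γ) (hA : 1 < A)
    (hx : 0 < x) (hK : 0 < K) {δ : ℝ} (hδ : δ = (γ / x - b) / 2) :
    ∃ C : ℝ, 0 < C ∧ ∀ ε ∈ Set.Ioc (0 : ℝ) (1 / 2), ∀ L : ℕ, A ^ L ≤ K * ε ^ (-(1 / α)) →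
      ε ^ (-x) * ((∑ ℓ ∈ Finset.Icc 1 L, (A ^ δ) ^ ℓ) ^ x *
        ∑ ℓ ∈ Finset.Icc 1 L, (A ^ (δ * x)) ^ ℓ) + ∑ ℓ ∈ Finset.Icc 1 L, (A ^ γ) ^ ℓ
      ≤ C * (ε ^ (-(γ / α)) +
        if γ / x < b then ε ^ (-x)
        else if b = γ / x then ε ^ (-x) * |Real.logb A ε| ^ (x + 1)
        else ε ^ (-x - (γ - b * x) / α)) := by
  have hA0 : 0 < A := by linarith
  have hgrow : ∀ {a : ℝ}, 0 < a → ∃ C : ℝ, 0 < C ∧ ∀ ε ∈ Set.Ioc (0 : ℝ) (1 / 2), ∀ L : ℕ,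
      A ^ L ≤ K * ε ^ (-(1 / α)) →
      ∑ ℓ ∈ Finset.Icc 1 L, (A ^ a) ^ ℓ ≤ C * ε ^ (-(a / α)) := by
    intro a ha
    have h1 : 1 < A ^ a := Real.one_lt_rpow hA ha
    have h2 : 0 < A ^ a / (A ^ a - 1) := div_pos (by positivity) (by linarith)
    refine ⟨A ^ a / (A ^ a - 1) * K ^ a, by positivity, fun ε hε L hL => ?_⟩
    refine (sum_Icc_pow_le_of_one_lt h1 L).trans ?_
    rw [mul_assoc]
    exact mul_le_mul_of_nonneg_left (level_rpow_le hA hK ha.le hε.1 hL) h2.le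
  have hdecay : ∀ {a : ℝ}, a < 0 → ∃ C : ℝ, 0 < C ∧ ∀ L : ℕ,
      ∑ ℓ ∈ Finset.Icc 1 L, (A ^ a) ^ ℓ ≤ C := by
    intro a ha
    have h1 : A ^ a < 1 := Real.rpow_lt_one_of_one_lt_of_neg hA ha
    exact ⟨A ^ a / (1 - A ^ a), div_pos (by positivity) (by linarith),
      sum_Icc_pow_le_of_lt_one (by positivity) h1⟩
  have hnn : ∀ (a : ℝ) (L : ℕ), 0 ≤ ∑ ℓ ∈ Finset.Icc 1 L, (A ^ a) ^ ℓ := fun a L =>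
    Finset.sum_nonneg fun ℓ _ => by positivity
  -- The last sum is the price of rounding the sample numbers up; it accounts for the term `ε ^ (-(γ
  -- / α))`.
  obtain ⟨C₀, hC₀, hU⟩ := hgrow hγ
  suffices hmain : ∃ C : ℝ, 0 < C ∧ ∀ ε ∈ Set.Ioc (0 : ℝ) (1 / 2), ∀ L : ℕ,
      A ^ L ≤ K * ε ^ (-(1 / α)) →
      ε ^ (-x) * ((∑ ℓ ∈ Finset.Icc 1 L, (A ^ δ) ^ ℓ) ^ x *
        ∑ ℓ ∈ Finset.Icc 1 L, (A ^ (δ * x)) ^ ℓ)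
      ≤ C * (if γ / x < b then ε ^ (-x)
        else if b = γ / x then ε ^ (-x) * |Real.logb A ε| ^ (x + 1)
        else ε ^ (-x - (γ - b * x) / α)) by
    obtain ⟨C, hC, hle⟩ := hmain
    refine ⟨C + C₀, by positivity, fun ε hε L hL => ?_⟩
    have h1 := hle ε hε L hL
    have h2 := hU ε hε L hL
    have h3 : 0 ≤ ε ^ (-(γ / α)) := Real.rpow_nonneg hε.1.le _
    have h4 : 0 ≤ (if γ / x < b then ε ^ (-x)
        else if b = γ / x then ε ^ (-x) * |Real.logb A ε| ^ (x + 1)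
        else ε ^ (-x - (γ - b * x) / α)) := by
      have := hε.1
      split_ifs <;> positivity
    nlinarith
  -- The sign of `δ` decides: bounded sums if negative, sums equal to `L` and total `L ^ (x + 1)` if
  -- zero, sums dominated by the last term if positive. In the last case `2 δ x = γ - b x` produces
  -- the exponent.
  rcases lt_trichotomy (γ / x) b with hb | hb | hb
  · have hδ0 : δ < 0 := by linarith
    obtain ⟨C₁, hC₁, h1⟩ := hdecay hδ0
    obtain ⟨C₂, hC₂, h2⟩ := hdecay (mul_neg_of_neg_of_pos hδ0 hx)
    refine ⟨C₁ ^ x * C₂, by positivity, fun ε hε L hL => ?_⟩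
    rw [if_pos hb, mul_comm]
    have hε0 := hε.1
    have := hnn δ L
    have := hnn (δ * x) L
    gcongr
    · exact h1 L
    · exact h2 L
  · have hδ0 : δ = 0 := by linarith
    obtain ⟨C, hC, h1⟩ := level_le_abs_logb hα hA hK
    refine ⟨C ^ (x + 1), by positivity, fun ε hε L hL => ?_⟩
    have hε0 := hε.1
    rw [if_neg hb.not_lt, if_pos hb.symm, hδ0, zero_mul, Real.rpow_zero]
    simp only [one_pow, Finset.sum_const, Nat.card_Icc, add_tsub_cancel_right, nsmul_eq_mul, mul_one]
    rw [mul_left_comm (C ^ (x + 1)), ← Real.mul_rpow hC.le (abs_nonneg _)]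
    gcongr
    calc (L : ℝ) ^ x * L = (L : ℝ) ^ (x + 1) := by
          rw [Real.rpow_add_of_nonneg (Nat.cast_nonneg L) hx.le zero_le_one, Real.rpow_one]
      _ ≤ _ := Real.rpow_le_rpow (Nat.cast_nonneg L) (h1 ε hε L hL) (by linarith)
  · have hδ0 : 0 < δ := by linarith
    obtain ⟨C₁, hC₁, h1⟩ := hgrow hδ0
    obtain ⟨C₂, hC₂, h2⟩ := hgrow (mul_pos hδ0 hx)
    refine ⟨C₁ ^ x * C₂, by positivity, fun ε hε L hL => ?_⟩
    have hε0 := hε.1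
    rw [if_neg hb.not_gt, if_neg hb.ne]
    calc _ ≤ ε ^ (-x) * ((C₁ * ε ^ (-(δ / α))) ^ x * (C₂ * ε ^ (-(δ * x / α)))) := by
          have := hnn δ L
          have := hnn (δ * x) L
          gcongr
          · exact h1 ε hε L hL
          · exact h2 ε hε L hL
      _ = C₁ ^ x * C₂ * (ε ^ (-x) * (ε ^ (-(δ / α) * x) * ε ^ (-(δ * x / α)))) := by
          rw [Real.mul_rpow hC₁.le (by positivity), ← Real.rpow_mul hε0.le]
          ring
      _ = _ := by
          rw [← Real.rpow_add hε0, ← Real.rpow_add hε0]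
          congr 2
          rw [hδ]
          field_simp
          ring

/-- For every accuracy there are a number of levels and sample numbers for which the error bound
is below the accuracy and the cost is of the order of the cost bound. -/
theorem exists_levels_and_samples {r α γ Cα Cβ Cγ c₁ c₂ : ℝ} {β : ℝ → ℝ} (hr : 1 < r) (hα : 0 < α)
    (hγ : 0 < γ) (hCα : 0 < Cα) (hCβ : 0 < Cβ) (hCγ : 0 < Cγ) (hA : 1 < A) (hc₁ : 0 < c₁)
    (hc₂ : 0 < c₂) (hβ : 0 < β r) :
    ∃ C : ℝ, 0 < C ∧ ∀ N cost : ℕ → ℝ,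
      (∀ ℓ, 1 ≤ ℓ → c₁ * A ^ ℓ ≤ N ℓ ∧ N ℓ ≤ c₂ * A ^ ℓ) →
      (∀ ℓ, 1 ≤ ℓ → cost ℓ ≤ Cγ * N ℓ ^ γ) →
      ∀ ε ∈ Set.Ioc (0 : ℝ) (1 / 2), ∃ (L : ℕ) (M : ℕ → ℕ), 1 ≤ L ∧ (∀ ℓ, 1 ≤ M ℓ) ∧
        Cα * N L ^ (-α) + ∑ ℓ ∈ Finset.Icc 1 L,
          (M ℓ : ℝ)⁻¹ * ((4 * M ℓ) ^ r⁻¹ * (Cβ * N ℓ ^ (-β r))) < ε ∧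
        mlmcCost cost L M ≤ C * costBound α γ β A r ε := by
  have hA0 : 0 < A := by linarith
  have hc : r.HolderConjugate (Real.conjExponent r) := .conjExponent hr
  set x := Real.conjExponent r with hxdef
  have hx : 0 < x := hc.symm.pos
  set b := β r with hb
  set δ : ℝ := (γ / x - b) / 2 with hδ
  -- `K₀` is chosen to make the bias at most `ε / 4`; the maximum in `K₁` meets the requirement `1 ≤
  -- K₁` of `exists_level`. The 4 in `K` bounds the factor `4 ^ r⁻¹` from von Bahr–Esseen.
  set K₀ : ℝ := 4 * (Cα * c₁ ^ (-α)) with hK₀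
  have hK₀pos : 0 < K₀ := by positivity
  set K₁ : ℝ := max 1 (K₀ ^ (1 / α)) with hK₁
  set K : ℝ := 4 * (Cβ * c₁ ^ (-b)) with hKdef
  have hK : 0 < K := by positivity
  have hK₁pos : 0 < K₁ := lt_max_of_lt_left one_pos
  obtain ⟨C, hC, hcost⟩ := weighted_geometric_cost_le (b := b) hα hγ hA hx
    (mul_pos hA0 hK₁pos) hδ
  have hD : 0 < Cγ * c₂ ^ γ * ((4 * K) ^ x + 1) * C := by positivity
  refine ⟨_, hD, fun N cost hN hcostN ε hε => ?_⟩
  have hε0 : 0 < ε := hε.1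
  obtain ⟨L, hL1, hLlow, hLup⟩ := exists_level hα hA (le_max_left 1 (K₀ ^ (1 / α))) hε
  have hNpos : ∀ ℓ, 1 ≤ ℓ → 0 < N ℓ := fun ℓ hℓ => lt_of_lt_of_le (by positivity) (hN ℓ hℓ).1
  have hNneg : ∀ ℓ, 1 ≤ ℓ → ∀ a : ℝ, 0 < a → N ℓ ^ (-a) ≤ c₁ ^ (-a) * (A ^ ℓ) ^ (-a) := by
    intro ℓ hℓ a ha
    rw [← Real.mul_rpow hc₁.le (by positivity)]
    exact Real.rpow_le_rpow_of_nonpos (by positivity) (hN ℓ hℓ).1 (by linarith)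
  have hswap : ∀ (ℓ : ℕ) (a : ℝ), (A ^ ℓ) ^ a = (A ^ a) ^ ℓ := fun ℓ a => by
    rw [← Real.rpow_natCast, ← Real.rpow_natCast, ← Real.rpow_mul hA0.le, ← Real.rpow_mul hA0.le,
      mul_comm]
  set W : ℝ := ∑ ℓ ∈ Finset.Icc 1 L, (A ^ δ) ^ ℓ with hW
  have hWpos : 0 < W := Finset.sum_pos (fun ℓ _ => by positivity) ⟨1, by simp [hL1]⟩
  -- With `M` samples the error on level `ℓ` is at most `M ^ (-1 / x) * K * (A ^ (-b)) ^ ℓ`, so `M ≥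
  -- Y ℓ ^ x` makes it at most `ε / (4 W) * (A ^ δ) ^ ℓ`, which sums to `ε / 4`. As `δ` is half of
  -- `γ / x - b`, the level costs are then proportional to `(A ^ (δ * x)) ^ ℓ`, up to rounding.
  set Y : ℕ → ℝ := fun ℓ => 4 * K / ε * W * (A ^ (-(b + δ))) ^ ℓ with hY
  have hYpos : ∀ ℓ, 0 < Y ℓ := fun ℓ => by positivity
  refine ⟨L, fun ℓ => ⌈Y ℓ ^ x⌉₊, hL1, fun ℓ => Nat.ceil_pos.2 (by have := hYpos ℓ; positivity),
    ?_, ?_⟩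
  · have hbias : Cα * N L ^ (-α) ≤ ε / 4 := by
      have h1 : (A ^ L) ^ (-α) ≤ K₀⁻¹ * ε := by
        calc (A ^ L) ^ (-α) ≤ (K₀ ^ (1 / α) * ε ^ (-(1 / α))) ^ (-α) := by
              refine Real.rpow_le_rpow_of_nonpos (by positivity) (le_trans ?_ hLlow) (by linarith)
              gcongr
              exact le_max_right _ _
          _ = _ := by
              rw [Real.mul_rpow (by positivity) (by positivity), ← Real.rpow_mul hK₀pos.le,
                ← Real.rpow_mul hε0.le, show 1 / α * -α = -1 by field_simp,
                show -(1 / α) * -α = 1 by field_simp, Real.rpow_neg_one, Real.rpow_one]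
      calc Cα * N L ^ (-α) ≤ Cα * (c₁ ^ (-α) * (K₀⁻¹ * ε)) := by
            gcongr
            refine (hNneg L hL1 α hα).trans ?_
            gcongr
        _ = ε / 4 := by
            rw [hK₀]; field_simp
    have hlevel : ∀ ℓ ∈ Finset.Icc 1 L, ((⌈Y ℓ ^ x⌉₊ : ℕ) : ℝ)⁻¹ *
        ((4 * (⌈Y ℓ ^ x⌉₊ : ℕ)) ^ r⁻¹ * (Cβ * N ℓ ^ (-b))) ≤ ε / (4 * W) * (A ^ δ) ^ ℓ := by
      intro ℓ hℓ
      have hℓ1 := (Finset.mem_Icc.1 hℓ).1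
      set m : ℝ := ((⌈Y ℓ ^ x⌉₊ : ℕ) : ℝ) with hm
      have hYx : 0 < Y ℓ ^ x := Real.rpow_pos_of_pos (hYpos ℓ) x
      have hmY : Y ℓ ^ x ≤ m := Nat.le_ceil _
      have hm0 : 0 < m := hYx.trans_le hmY
      have hfour : (4 : ℝ) ^ r⁻¹ ≤ 4 := by
        calc (4 : ℝ) ^ r⁻¹ ≤ 4 ^ (1 : ℝ) :=
              Real.rpow_le_rpow_of_exponent_le (by norm_num) (inv_le_one_of_one_le₀ hr.le)
          _ = 4 := Real.rpow_one _
      have hmr : m⁻¹ * m ^ r⁻¹ ≤ (Y ℓ)⁻¹ := by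
        calc m⁻¹ * m ^ r⁻¹ = m ^ (-x⁻¹) := by
              rw [← Real.rpow_neg_one, ← Real.rpow_add hm0]
              congr 1
              linarith [hc.inv_add_inv_eq_one]
          _ ≤ (Y ℓ ^ x) ^ (-x⁻¹) :=
              Real.rpow_le_rpow_of_nonpos hYx hmY (neg_nonpos.2 (by positivity))
          _ = (Y ℓ)⁻¹ := by
              rw [← Real.rpow_mul (hYpos ℓ).le, mul_neg, mul_inv_cancel₀ hx.ne', Real.rpow_neg_one]
      calc m⁻¹ * ((4 * m) ^ r⁻¹ * (Cβ * N ℓ ^ (-b)))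
          = m⁻¹ * m ^ r⁻¹ * (4 ^ r⁻¹ * (Cβ * N ℓ ^ (-b))) := by
            rw [Real.mul_rpow (by norm_num) hm0.le]; ring
        _ ≤ (Y ℓ)⁻¹ * (4 * (Cβ * (c₁ ^ (-b) * (A ^ ℓ) ^ (-b)))) := by
            have := Real.rpow_nonneg (hNpos ℓ hℓ1).le (-b)
            have := hYpos ℓ
            gcongr
            exact hNneg ℓ hℓ1 b hβ
        _ = ε / (4 * W) * (A ^ δ) ^ ℓ := by
            have e1 : (A ^ (-(b + δ))) ^ ℓ = (A ^ (-b)) ^ ℓ * ((A ^ δ) ^ ℓ)⁻¹ := by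
              rw [← inv_pow, ← mul_pow, ← Real.rpow_neg hA0.le, ← Real.rpow_add hA0]
              congr 2
              ring
            have e2 : 0 < (A ^ (-b)) ^ ℓ := by positivity
            have e3 : 0 < (A ^ δ) ^ ℓ := by positivity
            rw [hswap, hY]
            simp only [e1]
            rw [hKdef]
            field_simp
    calc _ ≤ ε / 4 + ∑ ℓ ∈ Finset.Icc 1 L, ε / (4 * W) * (A ^ δ) ^ ℓ :=
          add_le_add hbias (Finset.sum_le_sum hlevel)
      _ = ε / 2 := by
          rw [← Finset.mul_sum, ← hW]
          field_simp
          norm_num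
      _ < ε := by linarith
  · have hterm : ∀ ℓ ∈ Finset.Icc 1 L, ((⌈Y ℓ ^ x⌉₊ : ℕ) : ℝ) * cost ℓ
        ≤ Cγ * c₂ ^ γ * ((4 * K) ^ x * (ε ^ (-x) * (W ^ x * (A ^ (δ * x)) ^ ℓ)) + (A ^ γ) ^ ℓ) := by
      intro ℓ hℓ
      have hℓ1 := (Finset.mem_Icc.1 hℓ).1
      have hYx : 0 < Y ℓ ^ x := Real.rpow_pos_of_pos (hYpos ℓ) x
      have h1 : cost ℓ ≤ Cγ * (c₂ ^ γ * (A ^ γ) ^ ℓ) := by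
        refine (hcostN ℓ hℓ1).trans ?_
        gcongr
        rw [← hswap, ← Real.mul_rpow hc₂.le (by positivity)]
        exact Real.rpow_le_rpow (hNpos ℓ hℓ1).le (hN ℓ hℓ1).2 hγ.le
      have h2 : Y ℓ ^ x * (A ^ γ) ^ ℓ
          = (4 * K) ^ x * (ε ^ (-x) * (W ^ x * (A ^ (δ * x)) ^ ℓ)) := by
        have e1 : ((A ^ (-(b + δ))) ^ ℓ) ^ x * (A ^ γ) ^ ℓ = (A ^ (δ * x)) ^ ℓ := by
          rw [← hswap, ← Real.rpow_mul (by positivity), hswap, ← mul_pow, ← Real.rpow_add hA0]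
          congr 2
          rw [hδ]
          field_simp
          ring
        rw [← e1, hY]
        simp only
        rw [Real.mul_rpow (by positivity) (by positivity), Real.mul_rpow (by positivity) hWpos.le,
          Real.div_rpow (by positivity) hε0.le, Real.rpow_neg hε0.le]
        ring
      calc ((⌈Y ℓ ^ x⌉₊ : ℕ) : ℝ) * cost ℓ
          ≤ ((⌈Y ℓ ^ x⌉₊ : ℕ) : ℝ) * (Cγ * (c₂ ^ γ * (A ^ γ) ^ ℓ)) := by gcongr
        _ ≤ (Y ℓ ^ x + 1) * (Cγ * (c₂ ^ γ * (A ^ γ) ^ ℓ)) := by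
            gcongr
            exact (Nat.ceil_lt_add_one hYx.le).le
        _ = Cγ * c₂ ^ γ * (Y ℓ ^ x * (A ^ γ) ^ ℓ + (A ^ γ) ^ ℓ) := by ring
        _ = _ := by rw [h2]
    have hbound := hcost ε hε L hLup
    have hbracket : (ε ^ (-(γ / α)) +
        if γ / x < b then ε ^ (-x)
        else if b = γ / x then ε ^ (-x) * |Real.logb A ε| ^ (x + 1)
        else ε ^ (-x - (γ - b * x) / α)) = costBound α γ β A r ε := by
      simp only [costBound, ← hxdef, ← hb]
      split_ifs <;> rfl
    rw [hbracket, ← hW] at hbound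
    set V : ℝ := ∑ ℓ ∈ Finset.Icc 1 L, (A ^ (δ * x)) ^ ℓ
    set U : ℝ := ∑ ℓ ∈ Finset.Icc 1 L, (A ^ γ) ^ ℓ
    have hV : 0 ≤ V := Finset.sum_nonneg fun ℓ _ => by positivity
    have hU : 0 ≤ U := Finset.sum_nonneg fun ℓ _ => by positivity
    calc mlmcCost cost L (fun ℓ => ⌈Y ℓ ^ x⌉₊)
        ≤ ∑ ℓ ∈ Finset.Icc 1 L, Cγ * c₂ ^ γ *
            ((4 * K) ^ x * (ε ^ (-x) * (W ^ x * (A ^ (δ * x)) ^ ℓ)) + (A ^ γ) ^ ℓ) :=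
          Finset.sum_le_sum hterm
      _ = Cγ * c₂ ^ γ * ((4 * K) ^ x * (ε ^ (-x) * (W ^ x * V)) + U) := by
          simp only [← Finset.mul_sum, Finset.sum_add_distrib]
          rfl
      _ ≤ Cγ * c₂ ^ γ * (((4 * K) ^ x + 1) * (ε ^ (-x) * (W ^ x * V) + U)) := by
          gcongr
          have h1 : 0 ≤ (4 * K) ^ x * U := by positivity
          have h2 : 0 ≤ ε ^ (-x) * (W ^ x * V) := by positivity
          linarith
      _ ≤ Cγ * c₂ ^ γ * (((4 * K) ^ x + 1) * (C * costBound α γ β A r ε)) := by gcongr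
      _ = _ := by ring

end Numerics

/-! ### Error of the multilevel estimator. -/

section Error

variable {S : Type*} [MeasurableSpace S] {μ : Measure S}
  {Ω : Type*} [MeasurableSpace Ω] {P : Measure Ω}
  {p : ℝ≥0∞} [Fact (1 ≤ p)] {q qt α γ : ℝ} [Fact (1 ≤ ENNReal.ofReal qt)]
  {β : ℝ → ℝ} {A Cα Cβ Cγ c₁ c₂ : ℝ}
  {Xlim : Ω → Lp ℝ p μ} {X : ℕ → Ω → Lp ℝ p μ} {ξ : ℕ → ℕ → Ω → Lp ℝ p μ} {N cost : ℕ → ℝ}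

theorem Setting.memLp_all (H : Setting μ P q qt α γ β A Cα Cβ Cγ c₁ c₂ Xlim X ξ N cost) (ℓ : ℕ) :
    MemLp (X ℓ) (ENNReal.ofReal qt) P := by
  rcases Nat.eq_zero_or_pos ℓ with rfl | hℓ
  · rw [funext H.zero_level]
    exact MemLp.zero'
  · exact H.memLp_level ℓ hℓ

theorem Setting.integrable_level [IsProbabilityMeasure P]
    (H : Setting μ P q qt α γ β A Cα Cβ Cγ c₁ c₂ Xlim X ξ N cost) (ℓ : ℕ) :
    Integrable (X ℓ) P :=
  (H.memLp_all ℓ).integrable Fact.out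

/-- The error of the sample mean on one level. -/
theorem Setting.eLpNorm_level_le [SigmaFinite μ] [IsProbabilityMeasure P]
    (H : Setting μ P q qt α γ β A Cα Cβ Cγ c₁ c₂ Xlim X ξ N cost) (hq : 1 < q)
    (hp : p ≤ ENNReal.ofReal q) {r : ℝ}
    (hr : r ∈ Set.Icc q (min qt 2)) {ℓ : ℕ} (hℓ : 1 ≤ ℓ) {m : ℕ} (hm : 1 ≤ m) :
    eLpNorm (fun ω => ((∫ ω', X ℓ ω' ∂P) - ∫ ω', X (ℓ - 1) ω' ∂P) -
        (m : ℝ)⁻¹ • ∑ j ∈ Finset.range m, ξ ℓ j ω) (ENNReal.ofReal q) P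
      ≤ ENNReal.ofReal ((m : ℝ)⁻¹ * ((4 * m) ^ r⁻¹ * (Cβ * N ℓ ^ (-β r)))) := by
  have hqt : q ≤ qt := hr.1.trans (hr.2.trans (min_le_left _ _))
  set E : Lp ℝ p μ := (∫ ω', X ℓ ω' ∂P) - ∫ ω', X (ℓ - 1) ω' ∂P with hE
  set η : Ω → Lp ℝ p μ := fun ω =>
    X ℓ ω - (∫ ω', X ℓ ω' ∂P) - (X (ℓ - 1) ω - ∫ ω', X (ℓ - 1) ω' ∂P) with hη
  set Y : ℕ → Ω → Lp ℝ p μ := fun j ω => ξ ℓ j ω - E with hY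
  -- The difference bounded in `Setting.strong` is the centered increment, so the shifted samples `Y
  -- j` are copies of it.
  have hηE : η = fun ω => increment X ℓ ω - E := by
    funext ω
    simp only [hη, hE, increment]
    abel
  have hshift : Measurable fun y : Lp ℝ p μ => y - E := (by fun_prop : Continuous _).measurable
  have hηint : Integrable η P :=
    ((H.integrable_level ℓ).sub (integrable_const _)).sub
      ((H.integrable_level (ℓ - 1)).sub (integrable_const _))
  have hη0 : ∫ ω, η ω ∂P = 0 := by
    have hinc : Integrable (increment X ℓ) P :=
      (H.integrable_level ℓ).sub (H.integrable_level (ℓ - 1))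
    have hincE : ∫ ω, increment X ℓ ω ∂P = E :=
      integral_sub (H.integrable_level ℓ) (H.integrable_level (ℓ - 1))
    rw [hηE, integral_sub hinc (integrable_const _), hincE, integral_const, probReal_univ, one_smul,
      sub_self]
  have hYmem : ∀ j, MemLp (Y j) (ENNReal.ofReal q) P := fun j =>
    ((H.memLp_sample ℓ hℓ j).mono_exponent (ENNReal.ofReal_le_ofReal hqt)).sub (memLp_const E)
  have hid : ∀ j, IdentDistrib (Y j) η P P := fun j => by
    rw [hηE]
    exact (H.copy ℓ hℓ j).comp hshift
  have hsum := eLpNorm_sum_le_mixedNorm hq hr.1 (hr.2.trans (min_le_right _ _)) hp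
    hηint.aestronglyMeasurable ((H.indep ℓ hℓ).comp (fun _ y => y - E) fun _ => hshift)
    hYmem hid hη0 hm
  have hm0 : (m : ℝ) ≠ 0 := by exact_mod_cast (by omega : m ≠ 0)
  have hfun : (fun ω => E - (m : ℝ)⁻¹ • ∑ j ∈ Finset.range m, ξ ℓ j ω)
      = (-(m : ℝ)⁻¹) • fun ω => ∑ j ∈ Finset.range m, Y j ω := by
    funext ω
    simp only [hY, Pi.smul_apply, Finset.sum_sub_distrib, Finset.sum_const, Finset.card_range,
      smul_sub, neg_smul]
    rw [← Nat.cast_smul_eq_nsmul ℝ m E, smul_smul, inv_mul_cancel₀ hm0, one_smul]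
    abel
  rw [hfun, eLpNorm_const_smul, enorm_neg, Real.enorm_eq_ofReal (by positivity),
    ENNReal.ofReal_mul (by positivity), ENNReal.ofReal_mul (by positivity)]
  gcongr
  refine hsum.trans ?_
  gcongr
  exact H.strong r hr ℓ hℓ

/-- Bias and sampling error of the multilevel estimator. -/
theorem Setting.mlmcError_le [SigmaFinite μ] [IsProbabilityMeasure P]
    (H : Setting μ P q qt α γ β A Cα Cβ Cγ c₁ c₂ Xlim X ξ N cost) (hq : 1 < q)
    (hp : p ≤ ENNReal.ofReal q) (hCα : 0 ≤ Cα) (hCβ : 0 ≤ Cβ) (hNpos : ∀ ℓ, 1 ≤ ℓ → 0 < N ℓ)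
    {r : ℝ} (hr : r ∈ Set.Icc q (min qt 2)) {L : ℕ} (hL : 1 ≤ L) {M : ℕ → ℕ} (hM : ∀ ℓ, 1 ≤ M ℓ) :
    mlmcError P q Xlim ξ L M ≤ ENNReal.ofReal (Cα * N L ^ (-α) + ∑ ℓ ∈ Finset.Icc 1 L,
      (M ℓ : ℝ)⁻¹ * ((4 * M ℓ) ^ r⁻¹ * (Cβ * N ℓ ^ (-β r)))) := by
  have hqt : q ≤ qt := hr.1.trans (hr.2.trans (min_le_left _ _))
  have hq1 : 1 ≤ ENNReal.ofReal q := by simpa using ENNReal.ofReal_le_ofReal hq.le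
  set D : ℕ → Ω → Lp ℝ p μ := fun ℓ ω => ((∫ ω', X ℓ ω' ∂P) - ∫ ω', X (ℓ - 1) ω' ∂P) -
    (M ℓ : ℝ)⁻¹ • ∑ j ∈ Finset.range (M ℓ), ξ ℓ j ω with hD
  -- The level means telescope down to `X 0 = 0`, so only the bias at level `L` remains.
  have htel : ∀ n : ℕ, ∑ ℓ ∈ Finset.Icc 1 n, ((∫ ω', X ℓ ω' ∂P) - ∫ ω', X (ℓ - 1) ω' ∂P)
      = ∫ ω', X n ω' ∂P := by
    intro n
    induction n with
    | zero => simp [H.zero_level]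
    | succ n ih => rw [Finset.sum_Icc_succ_top (by omega), ih, add_tsub_cancel_right, add_sub_cancel]
  have hfun : (fun ω => (∫ ω', Xlim ω' ∂P) - estimator ξ L M ω)
      = (fun _ => (∫ ω', Xlim ω' ∂P) - ∫ ω', X L ω' ∂P) + ∑ ℓ ∈ Finset.Icc 1 L, D ℓ := by
    funext ω
    simp only [Pi.add_apply, Finset.sum_apply, hD, Finset.sum_sub_distrib (f := fun ℓ : ℕ =>
      (∫ ω', X ℓ ω' ∂P) - ∫ ω', X (ℓ - 1) ω' ∂P), htel, estimator]
    abel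
  have hDm : ∀ ℓ ∈ Finset.Icc 1 L, AEStronglyMeasurable (D ℓ) P := fun ℓ hℓ =>
    aestronglyMeasurable_const.sub ((Finset.aestronglyMeasurable_fun_sum _ fun j _ =>
      (H.memLp_sample ℓ (Finset.mem_Icc.1 hℓ).1 j).aestronglyMeasurable).fun_const_smul _)
  have hterm : ∀ ℓ, 1 ≤ ℓ → 0 ≤ (M ℓ : ℝ)⁻¹ * ((4 * M ℓ) ^ r⁻¹ * (Cβ * N ℓ ^ (-β r))) :=
    fun ℓ hℓ => by
      have := Real.rpow_nonneg (hNpos ℓ hℓ).le (-β r)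
      positivity
  have hbias0 : 0 ≤ Cα * N L ^ (-α) := mul_nonneg hCα (Real.rpow_nonneg (hNpos L hL).le _)
  rw [mlmcError, hfun, ENNReal.ofReal_add hbias0
    (Finset.sum_nonneg fun ℓ hℓ => hterm ℓ (Finset.mem_Icc.1 hℓ).1),
    ENNReal.ofReal_sum_of_nonneg fun ℓ hℓ => hterm ℓ (Finset.mem_Icc.1 hℓ).1]
  refine (eLpNorm_add_le aestronglyMeasurable_const
    (Finset.aestronglyMeasurable_sum _ hDm) hq1).trans (add_le_add ?_ ?_)
  · rw [eLpNorm_const' _ (zero_lt_one.trans_le hq1).ne' ENNReal.ofReal_ne_top, measure_univ,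
      ENNReal.one_rpow, mul_one, ← ofReal_norm]
    exact ENNReal.ofReal_le_ofReal (H.bias L hL)
  · refine (eLpNorm_sum_le hDm hq1).trans (Finset.sum_le_sum fun ℓ hℓ => ?_)
    exact H.eLpNorm_level_le hq hp hr (Finset.mem_Icc.1 hℓ).1 (hM ℓ)

end Error

end MLMC

/-! ### The main theorem. -/

theorem mainTheorem6
    (q qt : ℝ) (hq : q ∈ Set.Ioo (1 : ℝ) 2) (hqt : q ≤ qt) [Fact (1 ≤ ENNReal.ofReal qt)]
    (α γ Cα Cβ Cγ A c₁ c₂ : ℝ) (hα : 0 < α) (hγ : 0 < γ)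
    (hCα : 0 < Cα) (hCβ : 0 < Cβ) (hCγ : 0 < Cγ) (hA : 1 < A) (hc₁ : 0 < c₁) (hc₂ : 0 < c₂)
    (β : ℝ → ℝ) (b₀ b₁ : ℝ) (hb₁ : 0 < b₁)
    (hβ : ∀ r ∈ Set.Icc q (min qt 2), β r = b₀ + b₁ / r ∧ 0 < b₀ + b₁ / r) :
    -- the accuracy `ε` is achieved at the stated cost; the constant `C` depends only on the
    -- numerical parameters above
    (∃ C : ℝ, 0 < C ∧
      ∀ (S : Type u) [MeasurableSpace S] (μ : Measure S) [SigmaFinite μ]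
        (Ω : Type v) [MeasurableSpace Ω] (P : Measure Ω) [IsProbabilityMeasure P]
        (p : ℝ≥0∞) [Fact (1 ≤ p)]
        (Xlim : Ω → Lp ℝ p μ) (X : ℕ → Ω → Lp ℝ p μ) (ξ : ℕ → ℕ → Ω → Lp ℝ p μ)
        (N cost : ℕ → ℝ),
        MLMC.ApproximationByAveraging.{u, v} μ →
        p ≤ ENNReal.ofReal q →
        MLMC.Setting μ P q qt α γ β A Cα Cβ Cγ c₁ c₂ Xlim X ξ N cost →
        ∀ ε ∈ Set.Ioc (0 : ℝ) (1 / 2), ∃ (L : ℕ) (M : ℕ → ℕ),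
          1 ≤ L ∧ (∀ ℓ ∈ Finset.Icc 1 L, 1 ≤ M ℓ) ∧
          MLMC.mlmcError P q Xlim ξ L M < ENNReal.ofReal ε ∧
          MLMC.mlmcCost cost L M ≤ C * MLMC.optimalCostBound q (min qt 2) α γ b₀ b₁ A ε) ∧
    -- the bound is the optimal one among the bounds for the exponents `r ∈ [q, min qt 2]`
    (∃ r ∈ Set.Icc q (min qt 2), ∀ ε ∈ Set.Ioc (0 : ℝ) (1 / 2),
      MLMC.optimalCostBound q (min qt 2) α γ b₀ b₁ A ε = MLMC.costBound α γ β A r ε) ∧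
    (∀ r ∈ Set.Icc q (min qt 2), ∃ C : ℝ, 0 < C ∧ ∀ ε ∈ Set.Ioc (0 : ℝ) (1 / 2),
      MLMC.optimalCostBound q (min qt 2) α γ b₀ b₁ A ε ≤ C * MLMC.costBound α γ β A r ε) := by
  have hqh : q ≤ min qt 2 := le_min hqt hq.2.le
  -- The optimal `r` depends on numerical parameters only and is fixed before the spaces and random
  -- variables, so the constant for this single exponent is uniform.
  obtain ⟨r, hr, hopt⟩ := MLMC.exists_optimalCostBound_eq (α := α) (γ := γ) (A := A)
    hq.1 hqh hb₁ hβ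
  refine ⟨?_, ⟨r, hr, fun ε _ => hopt ε⟩,
    fun s hs => MLMC.optimalCostBound_le_costBound hq.1 hqh hb₁ hα hA hβ hs⟩
  have hβr : 0 < β r := (hβ r hr).1 ▸ (hβ r hr).2
  obtain ⟨C, hC, hmain⟩ := MLMC.exists_levels_and_samples (hq.1.trans_le hr.1) hα hγ hCα hCβ hCγ
    hA hc₁ hc₂ hβr
  refine ⟨C, hC, ?_⟩
  intro S _ μ _ Ω _ P _ p _ Xlim X ξ N cost _ hp H ε hε
  obtain ⟨L, M, hL, hM, herr, hcost⟩ := hmain N cost H.N_equiv H.cost_le ε hε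
  have hA0 : 0 < A := by linarith
  have hNpos : ∀ ℓ, 1 ≤ ℓ → 0 < N ℓ := fun ℓ hℓ =>
    lt_of_lt_of_le (by positivity) (H.N_equiv ℓ hℓ).1
  refine ⟨L, M, hL, fun ℓ _ => hM ℓ, ?_, by rw [hopt]; exact hcost⟩
  exact (H.mlmcError_le hq.1 hp hCα.le hCβ.le hNpos hr hL hM).trans_lt
    ((ENNReal.ofReal_lt_ofReal_iff hε.1).2 herr)
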